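/- A norm $\lVert\cdot\rVert$ on $\mathbb{R}^3$ is monotone if $\lVert x\rVert \ge \lVert x'\rVert$ whenever $|x_i| \ge |x_i'|$ for $i=1,2,3$. Let $\delta(a,b)=\lVert a-b\rVert$ be a metric on $\mathbb{R}^3$ induced by a monotone norm, and let $S$ be a set of $n\ge 2$ colored points in $\mathbb{R}^3$. A pair $\{a,b\}\subseteq S$ is bichromatic if $a$ and $b$ have different colors, and it is $o$-anchored, for a point $o\in\mathbb{R}^3$, if $o$ lies in the minimum axis-parallel bounding box of $\{a,b\}$. A $(1+\varepsilon)$-approximate anchored CRCP data structure on $S$ for box queries under $\delta$ answers every query $(B,o)$, where $B=[x^-,x^+]\times[y^-,y^+]\times[z^-,z^+]$ and $o\in\mathbb{R}^3$: it reports an $o$-anchored bichromatic pair $\{a,b\}\subseteq S\cap B$ with $\delta(a,b)\le(1+\varepsilon)\,\delta(a',b')$ for all $o$-anchored bichromatic pairs $\{a',b'\}\subseteq S\cap B$, or reports that there is no $o$-anchored bichromatic pair contained in $B$. The model is the real RAM: memory cells hold a real number or a word (an integer; the stored ones are at most the number of cells), and arithmetic operations (no rounding), comparisons, memory accesses and evaluations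 of $\delta$ take unit time. Space is the number of cells, including the working memory of the queries; preprocessing is not counted. Theorem. There are one query program and one absolute constant $C$ such that for every metric $\delta$ on $\mathbb{R}^3$ induced by a monotone norm, every $\varepsilon>0$ and every colored set $S$ of $n\ge2$ points in $\mathbb{R}^3$ there is a data structure on $S$ which, together with this program, is a $(1+\varepsilon)$-approximate anchored CRCP data structure for box queries under $\delta$, with space at most $C\,E^{2}\,n\log^6 n$ and query time at most $C\,(E^{2}\log^6 n+E^{4})$, where $E=\max\{1,\varepsilon^{-1}\}$. In particular, for $0<\varepsilon\le1$ it uses $O(\varepsilon^{-2}n\log^6 n)$ space and $O(\varepsilon^{-2}\log^6 n+\varepsilon^{-4})$ query time. -/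

import Mathlib

namespace CRCP

/-! ### Geometry: points, metrics, anchored bichromatic pairs -/

/-- Points of three-dimensional space (only the coordinates matter, no norm on this type is used). -/
abbrev Point : Type := Fin 3 → ℝ

/-- A monotone norm on three-dimensional space: a (definite) norm whose value does not increase
when the absolute values of the coordinates decrease. -/
structure IsMonotoneNorm (ν : Seminorm ℝ Point) : Prop where
  definite : ∀ x, ν x = 0 → x = 0
  mono : ∀ x y : Point, (∀ i, |y i| ≤ |x i|) → ν y ≤ ν x

/-- `δ` is the metric induced by some monotone norm. -/
def InducedByMonotoneNorm (δ : Point → Point → ℝ) : Prop :=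
  ∃ ν : Seminorm ℝ Point, IsMonotoneNorm ν ∧ ∀ a b, δ a b = ν (a - b)

/-- The bichromatic pairs of points of `S`. An unordered pair `{a, b}` is represented by both
`(a, b)` and `(b, a)`. -/
def bich {κ : Type*} (S : Finset Point) (cl : Point → κ) : Set (Point × Point) :=
  {φ | φ.1 ∈ S ∧ φ.2 ∈ S ∧ cl φ.1 ≠ cl φ.2}

/-- The minimum axis-parallel bounding box of the pair `φ`: the product over the coordinates `i`
of the intervals between `φ.1 i` and `φ.2 i`. -/
def boundingBox (φ : Point × Point) : Set Point :=
  {p | ∀ i, min (φ.1 i) (φ.2 i) ≤ p i ∧ p i ≤ max (φ.1 i) (φ.2 i)}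

/-- The axis-parallel box `[l 0, u 0] × [l 1, u 1] × [l 2, u 2]`. -/
def box (l u : Point) : Set Point := {p | ∀ i, l i ≤ p i ∧ p i ≤ u i}

/-- The `o`-anchored bichromatic pairs of `S` that are contained in the range `X`. -/
def anchoredBich {κ : Type*} (S : Finset Point) (cl : Point → κ) (X : Set Point) (o : Point) :
    Set (Point × Point) :=
  {φ | φ ∈ bich S cl ∧ o ∈ boundingBox φ ∧ φ.1 ∈ X ∧ φ.2 ∈ X}

/-- `φ` is a closest pair in `Pi` under `δ`. -/
def IsClosestPair (δ : Point → Point → ℝ) (Pi : Set (Point × Point)) (φ : Point × Point) : Prop :=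
  φ ∈ Pi ∧ ∀ ψ ∈ Pi, δ φ.1 φ.2 ≤ δ ψ.1 ψ.2

/-- `φ` is a `(1 + ε)`-approximate closest pair in `Pi` under `δ`. -/
def IsACP (δ : Point → Point → ℝ) (ε : ℝ) (Pi : Set (Point × Point)) (φ : Point × Point) : Prop :=
  φ ∈ Pi ∧ ∃ ψ, IsClosestPair δ Pi ψ ∧ δ φ.1 φ.2 ≤ (1 + ε) * δ ψ.1 ψ.2

/-! ### The machine: a real RAM with unit cost -/

/-- A static data structure in the memory of a real RAM: a read-only array of words (natural
numbers, used for indices, pointers, colour names) and a read-only array of reals, together with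
the numbers of word cells and of real cells that a query may use as working memory. -/
structure DataStructure where
  words : List ℕ
  reals : List ℝ
  workWords : ℕ
  workReals : ℕ

/-- The space: the number of all cells, working memory included. -/
def DataStructure.space (D : DataStructure) : ℕ :=
  D.words.length + D.reals.length + D.workWords + D.workReals

/-- Every stored word is at most the number of cells, so it has the size of a pointer. -/
def DataStructure.WordSized (D : DataStructure) : Prop :=
  ∀ w ∈ D.words, w ≤ D.space

/-- The mutable part of the machine: registers for words and for reals, and the working memory.
(A program is a finite text and so only uses a constant number of registers.) -/
structure State where
  word : ℕ → ℕ
  real : ℕ → ℝ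
  workWord : ℕ → ℕ
  workReal : ℕ → ℝ

namespace State

def setWord (s : State) (d v : ℕ) : State := { s with word := Function.update s.word d v }

noncomputable def setReal (s : State) (d : ℕ) (v : ℝ) : State :=
  { s with real := Function.update s.real d v }

def setWorkWord (s : State) (a v : ℕ) : State :=
  { s with workWord := Function.update s.workWord a v }

noncomputable def setWorkReal (s : State) (a : ℕ) (v : ℝ) : State :=
  { s with workReal := Function.update s.workReal a v }

end State

/-- Instructions. All arguments are numbers of registers, except the constants `c` and `q`;
`d` is the destination. There is neither a conversion between reals and words nor rounding. -/
inductive Instr where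
  | constWord (d c : ℕ)
  | copyWord (d a : ℕ)
  | addWord (d a b : ℕ)
  | subWord (d a b : ℕ)
  | constReal (d : ℕ) (q : ℚ)
  | copyReal (d a : ℕ)
  | addReal (d a b : ℕ)
  | subReal (d a b : ℕ)
  | mulReal (d a b : ℕ)
  | divReal (d a b : ℕ)
  | readWord (d a : ℕ)
  | readReal (d a : ℕ)
  | loadWord (d a : ℕ)
  | loadReal (d a : ℕ)
  | storeWord (a b : ℕ)
  | storeReal (a b : ℕ)
  | dist (d : ℕ) (p q : Fin 3 → ℕ)

/-- The effect of one instruction. There is no next state (the machine is stuck) on a division by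
zero and on an access outside the arrays. Subtraction of words is truncated at zero. The
instruction `dist` evaluates the metric at two points given by their coordinates. -/
inductive Step (δ : Point → Point → ℝ) (D : DataStructure) : Instr → State → State → Prop where
  | constWord (s : State) (d c : ℕ) : Step δ D (.constWord d c) s (s.setWord d c)
  | copyWord (s : State) (d a : ℕ) : Step δ D (.copyWord d a) s (s.setWord d (s.word a))
  | addWord (s : State) (d a b : ℕ) :
      Step δ D (.addWord d a b) s (s.setWord d (s.word a + s.word b))
  | subWord (s : State) (d a b : ℕ) :
      Step δ D (.subWord d a b) s (s.setWord d (s.word a - s.word b))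
  | constReal (s : State) (d : ℕ) (q : ℚ) : Step δ D (.constReal d q) s (s.setReal d (q : ℝ))
  | copyReal (s : State) (d a : ℕ) : Step δ D (.copyReal d a) s (s.setReal d (s.real a))
  | addReal (s : State) (d a b : ℕ) :
      Step δ D (.addReal d a b) s (s.setReal d (s.real a + s.real b))
  | subReal (s : State) (d a b : ℕ) :
      Step δ D (.subReal d a b) s (s.setReal d (s.real a - s.real b))
  | mulReal (s : State) (d a b : ℕ) :
      Step δ D (.mulReal d a b) s (s.setReal d (s.real a * s.real b))
  | divReal (s : State) (d a b : ℕ) (h : s.real b ≠ 0) :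
      Step δ D (.divReal d a b) s (s.setReal d (s.real a / s.real b))
  | readWord (s : State) (d a v : ℕ) (h : D.words[s.word a]? = some v) :
      Step δ D (.readWord d a) s (s.setWord d v)
  | readReal (s : State) (d a : ℕ) (v : ℝ) (h : D.reals[s.word a]? = some v) :
      Step δ D (.readReal d a) s (s.setReal d v)
  | loadWord (s : State) (d a : ℕ) (h : s.word a < D.workWords) :
      Step δ D (.loadWord d a) s (s.setWord d (s.workWord (s.word a)))
  | loadReal (s : State) (d a : ℕ) (h : s.word a < D.workReals) :
      Step δ D (.loadReal d a) s (s.setReal d (s.workReal (s.word a)))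
  | storeWord (s : State) (a b : ℕ) (h : s.word a < D.workWords) :
      Step δ D (.storeWord a b) s (s.setWorkWord (s.word a) (s.word b))
  | storeReal (s : State) (a b : ℕ) (h : s.word a < D.workReals) :
      Step δ D (.storeReal a b) s (s.setWorkReal (s.word a) (s.real b))
  | dist (s : State) (d : ℕ) (p q : Fin 3 → ℕ) :
      Step δ D (.dist d p q) s
        (s.setReal d (δ (fun i => s.real (p i)) (fun i => s.real (q i))))

/-- Tests on the contents of registers. -/
inductive Test where
  | eqWord (a b : ℕ)
  | ltWord (a b : ℕ)
  | leReal (a b : ℕ)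

def Test.Holds : Test → State → Prop
  | .eqWord a b, s => s.word a = s.word b
  | .ltWord a b, s => s.word a < s.word b
  | .leReal a b, s => s.real a ≤ s.real b

/-- Programs. -/
inductive Program where
  | skip
  | instr (i : Instr)
  | seq (p q : Program)
  | ite (c : Test) (p q : Program)
  | while (c : Test) (p : Program)

/-- `Exec δ D p s s' t`: started in the state `s` with the data structure `D`, the program `p`
halts in the state `s'` after `t` steps. Every instruction and every evaluation of a test takes
one step. -/
inductive Exec (δ : Point → Point → ℝ) (D : DataStructure) :
    Program → State → State → ℕ → Prop where
  | skip (s : State) : Exec δ D .skip s s 1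
  | instr (i : Instr) (s s' : State) (h : Step δ D i s s') : Exec δ D (.instr i) s s' 1
  | seq (p q : Program) (s s₁ s₂ : State) (t₁ t₂ : ℕ)
      (h₁ : Exec δ D p s s₁ t₁) (h₂ : Exec δ D q s₁ s₂ t₂) :
      Exec δ D (.seq p q) s s₂ (t₁ + t₂)
  | ite_true (c : Test) (p q : Program) (s s' : State) (t : ℕ)
      (hc : c.Holds s) (h : Exec δ D p s s' t) : Exec δ D (.ite c p q) s s' (1 + t)
  | ite_false (c : Test) (p q : Program) (s s' : State) (t : ℕ)
      (hc : ¬ c.Holds s) (h : Exec δ D q s s' t) : Exec δ D (.ite c p q) s s' (1 + t)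
  | while_true (c : Test) (p : Program) (s s₁ s₂ : State) (t₁ t₂ : ℕ)
      (hc : c.Holds s) (h₁ : Exec δ D p s s₁ t₁) (h₂ : Exec δ D (.while c p) s₁ s₂ t₂) :
      Exec δ D (.while c p) s s₂ (1 + t₁ + t₂)
  | while_false (c : Test) (p : Program) (s : State) (hc : ¬ c.Holds s) :
      Exec δ D (.while c p) s s 1

/-! ### Anchored data structures -/

/-- The state `s` carries the query with the box `box l u` and the anchor `o`: real registers
`0, 1, 2` hold `l`, registers `3, 4, 5` hold `u`, registers `6, 7, 8` hold `o`. Nothing is assumed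
about the other registers and about the working memory. -/
def State.HasQuery (s : State) (l u o : Point) : Prop :=
  ∀ i : Fin 3, s.real i = l i ∧ s.real (3 + i) = u i ∧ s.real (6 + i) = o i

/-- The pair of points that the state `s` displays in the real registers `0, …, 5`. -/
def State.outputPair (s : State) : Point × Point :=
  (fun i => s.real i, fun i => s.real (3 + i))

/-- The state `s` displays a correct answer for the set `Pi` of candidate pairs: if `Pi` is not
empty, word register `0` holds `1` and the displayed pair is a `(1 + ε)`-approximate closest pair
in `Pi`; if `Pi` is empty, word register `0` holds `0` (nothing is reported). -/
def State.Answers (s : State) (δ : Point → Point → ℝ) (ε : ℝ) (Pi : Set (Point × Point)) : Prop :=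
  (Pi.Nonempty → s.word 0 = 1 ∧ IsACP δ ε Pi s.outputPair) ∧ (Pi = ∅ → s.word 0 = 0)

/-- `D`, with query program `P`, is a `(1 + ε)`-approximate anchored data structure for box
queries under the metric `δ`, built on the dataset `S` coloured by `cl`, with query time at
most `T`. -/
def IsAnchoredCRCP {κ : Type*} (P : Program) (δ : Point → Point → ℝ) (ε : ℝ)
    (S : Finset Point) (cl : Point → κ) (D : DataStructure) (T : ℝ) : Prop :=
  ∀ (l u o : Point) (s : State), s.HasQuery l u o →
    ∃ (s' : State) (t : ℕ), Exec δ D P s s' t ∧ (t : ℝ) ≤ T ∧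
      s'.Answers δ ε (anchoredBich S cl (box l u) o)

end CRCP

namespace CRCP

/-! ### Weakest preconditions -/

/-! Geometry. The two points of an `o`-anchored pair lie in opposite closed octants around `o`. Let
`w i` be the norm of the `i`-th unit vector and give a point `p` of an octant the weighted offsets
`x i = w i * |p i - o i|`. Each octant is covered by cones: a main axis `k` and two slopes `μ`,
multiples of `1 / N`, with `x j ≤ μ * x k` for the other axes `j`. Suppose `a` has its largest
offset on axis `k`, and round its two slopes up. Then every `p` in that cone which is no farther
along axis `k` has offsets exceeding those of `a` by at most `x k / N` (`exists_cell`). Offsets of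
points in opposite octants add up to weighted coordinate differences. By monotonicity each of these
is at most the norm, and a uniform excess `r` costs at most `3 * r` in norm. Replacing both ends of
a pair in this way therefore loses only a factor `1 + 6 / N` (`IsMonotoneNorm.sub_le`).

Colours. In each cone it suffices to know a point minimising the main coordinate and a minimiser
among the points of another colour. Given a bichromatic pair, the two points kept in one cone and
the two kept in the opposite cone always contain a bichromatic replacement (`Covers.select_pair`).
So the `24 * N ^ 2` cones yield `O(N ^ 2)` candidates. Testing all pairs of candidates for being
valid takes `O(N ^ 4)` time and can never report a wrong pair (`exists_candidates`).

Searching. If any anchored pair exists, `o` lies in the query box, so in each octant only the far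
sides of the box matter, and those for the main axis come for free. A cone query is then a
conjunction of six one-sided conditions, each comparing a fixed function of the point with a linear
functional of the query. A six-level range tree answers it with `O(log ^ 6 n)` visits and `O(n log ^
6 n)` nodes (`exists_rangeTree`). With `N = ⌈6 * E⌉` this gives the bounds (`numeric_bounds`).

Machine. All trees are chained into one decision tree, traversed with an explicit stack. Loop-free
code is verified by weakest preconditions, and each of the loops by induction on the remaining work
(`runs_searchCode`, `runs_scanCode`). `runs_queryProgram` combines them. -/

/-- Weakest precondition of an instruction. -/
def Instr.wp (δ : Point → Point → ℝ) (D : DataStructure) : Instr → (State → Prop) → State → Prop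
  | .constWord d c, Q, s => Q (s.setWord d c)
  | .copyWord d a, Q, s => Q (s.setWord d (s.word a))
  | .addWord d a b, Q, s => Q (s.setWord d (s.word a + s.word b))
  | .subWord d a b, Q, s => Q (s.setWord d (s.word a - s.word b))
  | .constReal d q, Q, s => Q (s.setReal d (q : ℝ))
  | .copyReal d a, Q, s => Q (s.setReal d (s.real a))
  | .addReal d a b, Q, s => Q (s.setReal d (s.real a + s.real b))
  | .subReal d a b, Q, s => Q (s.setReal d (s.real a - s.real b))
  | .mulReal d a b, Q, s => Q (s.setReal d (s.real a * s.real b))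
  | .divReal d a b, Q, s => s.real b ≠ 0 ∧ Q (s.setReal d (s.real a / s.real b))
  | .readWord d a, Q, s => ∃ v, D.words[s.word a]? = some v ∧ Q (s.setWord d v)
  | .readReal d a, Q, s => ∃ v, D.reals[s.word a]? = some v ∧ Q (s.setReal d v)
  | .loadWord d a, Q, s => s.word a < D.workWords ∧ Q (s.setWord d (s.workWord (s.word a)))
  | .loadReal d a, Q, s => s.word a < D.workReals ∧ Q (s.setReal d (s.workReal (s.word a)))
  | .storeWord a b, Q, s => s.word a < D.workWords ∧ Q (s.setWorkWord (s.word a) (s.word b))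
  | .storeReal a b, Q, s => s.word a < D.workReals ∧ Q (s.setWorkReal (s.word a) (s.real b))
  | .dist d p q, Q, s =>
      Q (s.setReal d (δ (fun i => s.real (p i)) (fun i => s.real (q i))))

/-- Weakest precondition of a loop-free program (loops are not supported). -/
def Program.wp (δ : Point → Point → ℝ) (D : DataStructure) :
    Program → (State → Prop) → State → Prop
  | .skip, Q, s => Q s
  | .instr i, Q, s => i.wp δ D Q s
  | .seq p q, Q, s => p.wp δ D (q.wp δ D Q) s
  | .ite c p q, Q, s => (c.Holds s → p.wp δ D Q s) ∧ (¬ c.Holds s → q.wp δ D Q s)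
  -- Making loops unprovable here keeps `Runs.of_wp` sound; loops are handled by `Runs.while_true`
  -- and `Runs.while_false`.
  | .while _ _, _, _ => False

/-- Running time bound of a loop-free program. -/
def Program.cost : Program → ℕ
  | .skip => 1
  | .instr _ => 1
  | .seq p q => p.cost + q.cost
  | .ite _ p q => 1 + max p.cost q.cost
  | .while _ _ => 0

/-- Started in `s`, the program `p` halts within `T` steps in a state satisfying `Q`. -/
def Runs (δ : Point → Point → ℝ) (D : DataStructure) (p : Program) (s : State) (T : ℕ)
    (Q : State → Prop) : Prop :=
  ∃ s' t, Exec δ D p s s' t ∧ t ≤ T ∧ Q s'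

variable {δ : Point → Point → ℝ} {D : DataStructure}

theorem Instr.wp_step {i : Instr} {Q : State → Prop} {s : State} (h : i.wp δ D Q s) :
    ∃ s', Step δ D i s s' ∧ Q s' := by
  cases i with
  | constWord d c => exact ⟨_, .constWord .., h⟩
  | copyWord d c => exact ⟨_, .copyWord .., h⟩
  | addWord d a b => exact ⟨_, .addWord .., h⟩
  | subWord d a b => exact ⟨_, .subWord .., h⟩
  | constReal d c => exact ⟨_, .constReal .., h⟩
  | copyReal d c => exact ⟨_, .copyReal .., h⟩
  | addReal d a b => exact ⟨_, .addReal .., h⟩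
  | subReal d a b => exact ⟨_, .subReal .., h⟩
  | mulReal d a b => exact ⟨_, .mulReal .., h⟩
  | divReal d a b => exact ⟨_, .divReal _ _ _ _ h.1, h.2⟩
  | readWord d a => obtain ⟨v, hv, hQ⟩ := h; exact ⟨_, .readWord _ _ _ _ hv, hQ⟩
  | readReal d a => obtain ⟨v, hv, hQ⟩ := h; exact ⟨_, .readReal _ _ _ _ hv, hQ⟩
  | loadWord d a => exact ⟨_, .loadWord _ _ _ h.1, h.2⟩
  | loadReal d a => exact ⟨_, .loadReal _ _ _ h.1, h.2⟩
  | storeWord d a => exact ⟨_, .storeWord _ _ _ h.1, h.2⟩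
  | storeReal d a => exact ⟨_, .storeReal _ _ _ h.1, h.2⟩
  | dist d p q => exact ⟨_, .dist .., h⟩

theorem Runs.mono {p : Program} {s : State} {T T' : ℕ} {Q Q' : State → Prop}
    (h : Runs δ D p s T Q) (hT : T ≤ T') (hQ : ∀ s, Q s → Q' s) : Runs δ D p s T' Q' := by
  obtain ⟨s', t, he, ht, hq⟩ := h
  exact ⟨s', t, he, ht.trans hT, hQ _ hq⟩

theorem Runs.seq {p q : Program} {s : State} {T₁ T₂ : ℕ} {Q : State → Prop}
    (h : Runs δ D p s T₁ (fun s' => Runs δ D q s' T₂ Q)) :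
    Runs δ D (.seq p q) s (T₁ + T₂) Q := by
  obtain ⟨s₁, t₁, he₁, ht₁, s₂, t₂, he₂, ht₂, hq⟩ := h
  exact ⟨s₂, t₁ + t₂, .seq _ _ _ _ _ _ _ he₁ he₂, by omega, hq⟩

theorem Runs.while_true {c : Test} {p : Program} {s : State} {T₁ T₂ : ℕ} {Q : State → Prop}
    (hc : c.Holds s) (h : Runs δ D p s T₁ (fun s' => Runs δ D (.while c p) s' T₂ Q)) :
    Runs δ D (.while c p) s (1 + T₁ + T₂) Q := by
  obtain ⟨s₁, t₁, he₁, ht₁, s₂, t₂, he₂, ht₂, hq⟩ := h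
  exact ⟨s₂, 1 + t₁ + t₂, .while_true _ _ _ _ _ _ _ hc he₁ he₂, by omega, hq⟩

theorem Runs.while_false {c : Test} {p : Program} {s : State} {Q : State → Prop}
    (hc : ¬ c.Holds s) (h : Q s) : Runs δ D (.while c p) s 1 Q :=
  ⟨s, 1, .while_false _ _ _ hc, le_rfl, h⟩

theorem Runs.of_wp {p : Program} {s : State} {Q : State → Prop} (h : p.wp δ D Q s) :
    Runs δ D p s p.cost Q := by
  induction p generalizing s Q with
  | skip => exact ⟨s, 1, .skip s, le_rfl, h⟩
  | instr i =>
    obtain ⟨s', hs, hq⟩ := Instr.wp_step h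
    exact ⟨s', 1, .instr _ _ _ hs, le_rfl, hq⟩
  | seq p q ihp ihq => exact Runs.seq ((ihp h).mono le_rfl fun _ h' => ihq h')
  | ite c p q ihp ihq =>
    by_cases hc : c.Holds s
    · obtain ⟨s', t, he, ht, hq⟩ := ihp (h.1 hc)
      exact ⟨s', 1 + t, .ite_true _ _ _ _ _ _ hc he, by simp only [Program.cost]; omega, hq⟩
    · obtain ⟨s', t, he, ht, hq⟩ := ihq (h.2 hc)
      exact ⟨s', 1 + t, .ite_false _ _ _ _ _ _ hc he, by simp only [Program.cost]; omega, hq⟩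
  | _ => exact h.elim

namespace State

variable (s : State) (d x v : ℕ) (r : ℝ)

@[simp] theorem setWord_word : (s.setWord d v).word x = if x = d then v else s.word x := by
  simp [setWord, Function.update_apply]
@[simp] theorem setWord_real : (s.setWord d v).real = s.real := rfl
@[simp] theorem setWord_workWord : (s.setWord d v).workWord = s.workWord := rfl
@[simp] theorem setReal_real : (s.setReal d r).real x = if x = d then r else s.real x := by
  simp [setReal, Function.update_apply]
@[simp] theorem setReal_word : (s.setReal d r).word = s.word := rfl
@[simp] theorem setReal_workWord : (s.setReal d r).workWord = s.workWord := rfl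
@[simp] theorem setWorkWord_word : (s.setWorkWord d v).word = s.word := rfl
@[simp] theorem setWorkWord_real : (s.setWorkWord d v).real = s.real := rfl
@[simp] theorem setWorkWord_workWord :
    (s.setWorkWord d v).workWord x = if x = d then v else s.workWord x := by
  simp [setWorkWord, Function.update_apply]

end State

/-- Straight-line programs. -/
def block : List Instr → Program
  | [] => .skip
  | i :: l => .seq (.instr i) (block l)

/-! ### The search phase

Word registers: 0 answer flag, 1, 2, 3 the constants 0, 1, 2, 4 stack pointer, 5 output pointer,
6 current node, 7 its kind, 8, 9 scratch, 10, 12 pointers to the best two points, 11 colour of the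
best point, 19, 20 pointer and colour of a new point.
Real registers: 0-8 the query, 9, 10 scratch, 11, 12 values of the best two points, 13 value of a
new point. The stack occupies the even cells of the working memory, the output the odd ones. -/

/-- Decision trees over a query in `Fin 9 → ℝ`. `branch v c a b e` leads to `a` and then `b` if
`v ≤ c ⬝ᵥ q`, and to `e` otherwise. -/
inductive Tree where
  | nil
  | insert (pt col : ℕ) (x : ℝ)
  | flush (x : ℝ)
  | branch (v : ℝ) (c : Fin 9 → ℝ) (a b e : Tree)

/-- The accumulator of a tree traversal: the best point with its colour and value, the best point
of another colour with its value, and the output. -/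
structure Acc where
  p₁ : ℕ
  c₁ : ℕ
  x₁ : ℝ
  p₂ : ℕ
  x₂ : ℝ
  out : List ℕ

open Classical in
/-- Take a new point into account. -/
noncomputable def Acc.insert (A : Acc) (pt col : ℕ) (x : ℝ) : Acc :=
  if col = A.c₁ then
    if A.x₁ ≤ x then A else { A with p₁ := pt, x₁ := x }
  else if A.x₁ ≤ x then
    if A.x₂ ≤ x then A else { A with p₂ := pt, x₂ := x }
  else { A with p₁ := pt, c₁ := col, x₁ := x, p₂ := A.p₁, x₂ := A.x₁ }

/-- Output the best points and start again. -/
def Acc.flush (A : Acc) (x : ℝ) : Acc :=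
  { p₁ := 0, c₁ := 0, x₁ := x, p₂ := 0, x₂ := x, out := A.out ++ [A.p₁, A.p₂] }

namespace Tree

open Classical in
/-- The traversal of a tree. -/
noncomputable def process (q : Fin 9 → ℝ) : Tree → Acc → Acc
  | nil, A => A
  | insert pt col x, A => A.insert pt col x
  | flush x, A => A.flush x
  | branch v c a b e, A =>
      if v ≤ c ⬝ᵥ q then b.process q (a.process q A) else e.process q A

open Classical in
/-- The number of nodes met by the traversal. -/
noncomputable def visits (q : Fin 9 → ℝ) : Tree → ℕ
  | nil => 1
  | insert _ _ _ => 1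
  | flush _ => 1
  | branch v c a b e => 1 + if v ≤ c ⬝ᵥ q then a.visits q + b.visits q else e.visits q

/-- The number of nodes. -/
def size : Tree → ℕ
  | nil => 1
  | insert _ _ _ => 1
  | flush _ => 1
  | branch _ _ a b e => 1 + a.size + b.size + e.size

theorem visits_pos (q : Fin 9 → ℝ) (T : Tree) : 1 ≤ T.visits q := by
  cases T <;> simp [visits]

/-- The tree is stored at the address `p`. -/
def Rep (D : DataStructure) : Tree → ℕ → Prop
  | nil, p => D.words[p]? = some 3
  | insert pt col x, p => D.words[p]? = some 1 ∧ D.words[p + 1]? = some pt ∧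
      D.words[p + 2]? = some col ∧ D.reals[p]? = some x
  | flush x, p => D.words[p]? = some 2 ∧ D.reals[p]? = some x
  | branch v c a b e, p => D.words[p]? = some 0 ∧ D.reals[p]? = some v ∧
      (∀ i : Fin 9, D.reals[p + (i + 1)]? = some (c i)) ∧
      (∃ pa, D.words[p + 1]? = some pa ∧ a.Rep D pa) ∧
      (∃ pb, D.words[p + 2]? = some pb ∧ b.Rep D pb) ∧
      (∃ pe, D.words[p + 3]? = some pe ∧ e.Rep D pe)

end Tree

/-- A stack of trees in the even cells, with the top at the highest address. -/
def StackRep (D : DataStructure) (m : ℕ → ℕ) : List Tree → Prop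
  | [] => True
  | T :: st => T.Rep D (m (2 * st.length)) ∧ StackRep D m st

/-- The stack sees only the even cells below its top, so pushes above it and outputs to odd cells do
no harm. -/
theorem StackRep.congr {m m' : ℕ → ℕ} {st : List Tree} (h : StackRep D m st)
    (hm : ∀ i < st.length, m' (2 * i) = m (2 * i)) : StackRep D m' st := by
  induction st with
  | nil => trivial
  | cons T st ih =>
    refine ⟨?_, ih h.2 fun i hi => hm i (by simp; omega)⟩
    rw [hm _ (by simp)]
    exact h.1

/-- The state `s` holds the query `q`, the stack `st` and the accumulator `A`. -/
structure Searching (D : DataStructure) (q : Fin 9 → ℝ) (s : State) (st : List Tree) (A : Acc) :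
    Prop where
  query : ∀ i : Fin 9, s.real i = q i
  flag : s.word 0 = 0
  zero : s.word 1 = 0
  one : s.word 2 = 1
  two : s.word 3 = 2
  sp : s.word 4 = 2 * st.length
  op : s.word 5 = 2 * A.out.length + 1
  p₁ : s.word 10 = A.p₁
  c₁ : s.word 11 = A.c₁
  x₁ : s.real 11 = A.x₁
  p₂ : s.word 12 = A.p₂
  x₂ : s.real 12 = A.x₂
  stack : StackRep D s.workWord st
  out : ∀ i (h : i < A.out.length), s.workWord (2 * i + 1) = A.out[i]

/-- Add the product of the `i`-th coefficient of the current node and the `i`-th query entry. -/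
def dotStep (i : ℕ) : Program :=
  block [.constWord 8 (i + 1), .addWord 8 6 8, .readReal 10 8, .mulReal 10 10 i, .addReal 9 9 10]

def dotSteps : List ℕ → Program
  | [] => .skip
  | i :: l => .seq (dotStep i) (dotSteps l)

/-- Push the `k`-th word of the current node. -/
def push (k : ℕ) : Program :=
  block [.constWord 8 k, .addWord 8 6 8, .readWord 9 8, .storeWord 4 9, .addWord 4 4 3]

/-- On success the second child is pushed before the first, so that the first is popped first and
the stack order agrees with `Tree.process`. -/
def branchCode : Program :=
  .seq (.instr (.constReal 9 0)) (.seq (dotSteps [0, 1, 2, 3, 4, 5, 6, 7, 8])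
    (.seq (.instr (.readReal 10 6)) (.ite (.leReal 10 9) (.seq (push 2) (push 1)) (push 3))))

def insertCode : Program :=
  .seq (block [.constWord 8 1, .addWord 8 6 8, .readWord 19 8, .constWord 8 2, .addWord 8 6 8,
      .readWord 20 8, .readReal 13 6])
    (.ite (.eqWord 20 11)
      (.ite (.leReal 11 13) .skip (block [.copyWord 10 19, .copyReal 11 13]))
      (.ite (.leReal 11 13)
        (.ite (.leReal 12 13) .skip (block [.copyWord 12 19, .copyReal 12 13]))
        (block [.copyWord 12 10, .copyReal 12 11, .copyWord 10 19, .copyWord 11 20,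
          .copyReal 11 13])))

/-- Registers 1 and 3 hold 0 and 2: the output pointer moves from odd cell to odd cell, and the
accumulated pointers and colour are reset to 0. -/
def flushCode : Program :=
  block [.storeWord 5 10, .addWord 5 5 3, .storeWord 5 12, .addWord 5 5 3, .copyWord 10 1,
    .copyWord 12 1, .copyWord 11 1, .readReal 11 6, .copyReal 12 11]

/-- Registers 1, 2, 3 hold the constants 0, 1, 2, so these are the tests for the kinds branch,
insert and flush; kind 3 needs no action. -/
def visitCode : Program :=
  .seq (block [.subWord 4 4 3, .loadWord 6 4, .readWord 7 6])
    (.ite (.eqWord 7 1) branchCode (.ite (.eqWord 7 2) insertCode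
      (.ite (.eqWord 7 3) flushCode .skip)))

def searchCode : Program := .while (.ltWord 1 4) visitCode

/-- Two states differ only in scratch registers. -/
structure SameButScratch (s s' : State) : Prop where
  word : ∀ x, x ≠ 8 → s'.word x = s.word x
  real : ∀ x, x ≠ 9 → x ≠ 10 → s'.real x = s.real x
  workWord : s'.workWord = s.workWord

/-! ### Verification of the tree traversal -/

theorem wp_dotSteps {q c : Fin 9 → ℝ} {Q : State → Prop} (l : List (Fin 9)) {s : State}
    (hq : ∀ i : Fin 9, s.real i = q i)
    (hc : ∀ i : Fin 9, D.reals[s.word 6 + (i + 1)]? = some (c i))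
    (h : ∀ s', SameButScratch s s' → s'.real 9 = s.real 9 + (l.map fun i => c i * q i).sum → Q s') :
    (dotSteps (l.map Fin.val)).wp δ D Q s := by
  induction l generalizing s with
  | nil => exact h s ⟨fun _ _ => rfl, fun _ _ _ => rfl, rfl⟩ (by simp)
  | cons i l ih =>
    have hi : (i : ℕ) ≠ 10 := by omega
    simp only [List.map_cons, dotSteps, dotStep, block, Program.wp, Instr.wp]
    refine ⟨c i, by simpa using hc i, ?_⟩
    apply ih
    · intro j
      have hj : (j : ℕ) ≠ 10 := by omega
      have hj' : (j : ℕ) ≠ 9 := by omega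
      simp [hj, hj', hq]
    · intro j
      simpa using hc j
    · intro s' hs' h9
      apply h s'
      · refine ⟨fun x hx => ?_, fun x hx hx' => ?_, ?_⟩
        · rw [hs'.word x hx]; simp [hx]
        · rw [hs'.real x hx hx']; simp [hx, hx']
        · rw [hs'.workWord]; simp
      · rw [h9]
        simp [hi, hq, add_assoc]

theorem wp_push {k v : ℕ} {Q : State → Prop} {s : State} (hv : D.words[s.word 6 + k]? = some v)
    (hw : s.word 4 < D.workWords)
    (h : ∀ s' : State, (∀ x, x ≠ 8 → x ≠ 9 → x ≠ 4 → s'.word x = s.word x) →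
      s'.word 4 = s.word 4 + s.word 3 → s'.real = s.real →
      (∀ x, s'.workWord x = if x = s.word 4 then v else s.workWord x) → Q s') :
    (push k).wp δ D Q s := by
  simp only [push, block, Program.wp, Instr.wp]
  refine ⟨v, by simpa using hv, ?_, ?_⟩
  · simpa using hw
  · apply h
    · intro x h8 h9 h4
      simp [h8, h9, h4]
    · simp
    · simp
    · intro x
      simp

/-- One more tree on the stack. -/
theorem Searching.push {q : Fin 9 → ℝ} {s s' : State} {st : List Tree} {A : Acc} {T : Tree} {v : ℕ}
    (h : Searching D q s st A) (hT : T.Rep D v)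
    (hw : ∀ x, x ≠ 8 → x ≠ 9 → x ≠ 4 → s'.word x = s.word x)
    (h4 : s'.word 4 = s.word 4 + s.word 3) (hr : s'.real = s.real)
    (hm : ∀ x, s'.workWord x = if x = s.word 4 then v else s.workWord x) :
    Searching D q s' (T :: st) A where
  query i := by rw [hr, h.query]
  flag := by rw [hw _ (by decide) (by decide) (by decide), h.flag]
  zero := by rw [hw _ (by decide) (by decide) (by decide), h.zero]
  one := by rw [hw _ (by decide) (by decide) (by decide), h.one]
  two := by rw [hw _ (by decide) (by decide) (by decide), h.two]
  sp := by rw [h4, h.sp, h.two]; simp; omega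
  op := by rw [hw _ (by decide) (by decide) (by decide), h.op]
  p₁ := by rw [hw _ (by decide) (by decide) (by decide), h.p₁]
  c₁ := by rw [hw _ (by decide) (by decide) (by decide), h.c₁]
  x₁ := by rw [hr, h.x₁]
  p₂ := by rw [hw _ (by decide) (by decide) (by decide), h.p₂]
  x₂ := by rw [hr, h.x₂]
  stack := by
    refine ⟨?_, h.stack.congr fun i hi => ?_⟩
    · rw [hm, h.sp, if_pos rfl]; exact hT
    · rw [hm, h.sp, if_neg (by omega)]
  out i hi := by rw [hm, h.sp, if_neg (by omega)]; exact h.out i hi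

theorem wp_push_searching {k v : ℕ} {Q : State → Prop} {s : State} {q : Fin 9 → ℝ}
    {st : List Tree} {A : Acc} {T : Tree} (h : Searching D q s st A)
    (hv : D.words[s.word 6 + k]? = some v) (hT : T.Rep D v) (hw : 2 * st.length < D.workWords)
    (hQ : ∀ s', s'.word 6 = s.word 6 → Searching D q s' (T :: st) A → Q s') :
    (CRCP.push k).wp δ D Q s := by
  refine wp_push hv (by rwa [h.sp]) fun s' h1 h2 h3 h4 => ?_
  exact hQ s' (h1 _ (by decide) (by decide) (by decide)) (h.push hT h1 h2 h3 h4)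

theorem wp_branchCode {Q : State → Prop} {s : State} {q : Fin 9 → ℝ}
    {st : List Tree} {A : Acc} {v : ℝ} {c : Fin 9 → ℝ} {a b e : Tree}
    (h : Searching D q s st A) (hT : (Tree.branch v c a b e).Rep D (s.word 6))
    (hw : 2 * (st.length + 2) ≤ D.workWords)
    (hyes : v ≤ c ⬝ᵥ q → ∀ s', Searching D q s' (a :: b :: st) A → Q s')
    (hno : ¬ v ≤ c ⬝ᵥ q → ∀ s', Searching D q s' (e :: st) A → Q s') :
    branchCode.wp δ D Q s := by
  obtain ⟨-, hv, hc, ⟨pa, hpa, ha⟩, ⟨pb, hpb, hb⟩, ⟨pe, hpe, he⟩⟩ := hT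
  have hlt : ∀ i : Fin 9, (i : ℕ) ≠ 9 ∧ (i : ℕ) ≠ 10 := by decide
  simp only [branchCode, Program.wp, Instr.wp]
  refine wp_dotSteps (q := q) (c := c) [0, 1, 2, 3, 4, 5, 6, 7, 8] ?_ ?_ ?_
  · intro i
    simp [(hlt i).1, h.query]
  · simpa using hc
  intro s' hs' h9
  have hdot : s'.real 9 = c ⬝ᵥ q := by
    rw [h9]
    simp [dotProduct, Fin.sum_univ_succ]
  have h6 : s'.word 6 = s.word 6 := hs'.word _ (by decide)
  refine ⟨v, by rw [h6]; exact hv, ?_⟩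
  set s₂ := s'.setReal 10 v with hs₂
  have hw2 : ∀ x, x ≠ 8 → s₂.word x = s.word x := fun x hx => hs'.word x hx
  have hr2 : ∀ x, x ≠ 9 → x ≠ 10 → s₂.real x = s.real x := fun x hx hx' => by
    simp [hs₂, hx', hs'.real x hx hx', hx]
  have hm2 : s₂.workWord = s.workWord := hs'.workWord
  have hS : Searching D q s₂ st A :=
    { query := fun i => by rw [hr2 _ (hlt i).1 (hlt i).2, h.query]
      flag := by rw [hw2 _ (by decide), h.flag]
      zero := by rw [hw2 _ (by decide), h.zero]
      one := by rw [hw2 _ (by decide), h.one]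
      two := by rw [hw2 _ (by decide), h.two]
      sp := by rw [hw2 _ (by decide), h.sp]
      op := by rw [hw2 _ (by decide), h.op]
      p₁ := by rw [hw2 _ (by decide), h.p₁]
      c₁ := by rw [hw2 _ (by decide), h.c₁]
      x₁ := by rw [hr2 _ (by decide) (by decide), h.x₁]
      p₂ := by rw [hw2 _ (by decide), h.p₂]
      x₂ := by rw [hr2 _ (by decide) (by decide), h.x₂]
      stack := by rw [hm2]; exact h.stack
      out := by rw [hm2]; exact h.out }
  have h6' : s₂.word 6 = s.word 6 := h6
  -- Register 10 now holds the threshold and register 9 the accumulated scalar product.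
  have htest : (Test.leReal 10 9).Holds s₂ ↔ v ≤ c ⬝ᵥ q := by
    simp [Test.Holds, hs₂, hdot]
  refine ⟨fun ht => ?_, fun ht => ?_⟩
  · refine wp_push_searching hS (by rw [h6']; exact hpb) hb (by omega) fun s₃ h63 hS₃ => ?_
    refine wp_push_searching hS₃ (by rw [h63, h6']; exact hpa) ha
      (by simp only [List.length_cons]; omega) fun s₄ h64 hS₄ => ?_
    exact hyes (htest.1 ht) _ hS₄
  · refine wp_push_searching hS (by rw [h6']; exact hpe) he (by omega) fun s₃ h63 hS₃ => ?_
    exact hno (fun h' => ht (htest.2 h')) _ hS₃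

set_option linter.unusedSimpArgs false in
theorem wp_insertCode {Q : State → Prop} {s : State} {q : Fin 9 → ℝ}
    {st : List Tree} {A : Acc} {pt col : ℕ} {x : ℝ}
    (h : Searching D q s st A) (hT : (Tree.insert pt col x).Rep D (s.word 6))
    (hQ : ∀ s', Searching D q s' st (A.insert pt col x) → Q s') :
    insertCode.wp δ D Q s := by
  obtain ⟨-, h1, h2, hx⟩ := hT
  have hlt : ∀ i : Fin 9, (i : ℕ) ≠ 9 ∧ (i : ℕ) ≠ 10 ∧ (i : ℕ) ≠ 11 ∧ (i : ℕ) ≠ 12 ∧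
      (i : ℕ) ≠ 13 := by decide
  simp only [insertCode, block, Program.wp, Instr.wp]
  refine ⟨pt, by simpa using h1, col, by simpa using h2, x, by simpa using hx, ?_⟩
  simp only [Test.Holds, State.setWord_word, State.setReal_real, State.setWord_real,
    State.setReal_word, h.c₁, h.x₁, h.x₂, h.p₁]
  norm_num
  refine ⟨fun hc => ⟨fun hx1 => ?_, fun hx1 => ?_⟩, fun hc => ⟨fun hx1 => ⟨fun hx2 => ?_,
    fun hx2 => ?_⟩, fun hx1 => ?_⟩⟩ <;> apply hQ
  · constructor <;>
      simp [Acc.insert, hc, hx1, h.flag, h.zero, h.one, h.two, h.sp, h.op, h.p₁, h.c₁, h.x₁, h.p₂,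
        h.x₂, hlt, h.query, h.stack]
    exact h.out
  · constructor <;>
      simp [Acc.insert, hc, not_le.2 hx1, h.flag, h.zero, h.one, h.two, h.sp, h.op, h.p₁, h.c₁,
        h.x₁, h.p₂, h.x₂, hlt, h.query, h.stack]
    exact h.out
  · constructor <;>
      simp [Acc.insert, hc, hx1, hx2, h.flag, h.zero, h.one, h.two, h.sp, h.op, h.p₁, h.c₁, h.x₁,
        h.p₂, h.x₂, hlt, h.query, h.stack]
    exact h.out
  · constructor <;>
      simp [Acc.insert, hc, hx1, not_le.2 hx2, h.flag, h.zero, h.one, h.two, h.sp, h.op, h.p₁,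
        h.c₁, h.x₁, h.p₂, h.x₂, hlt, h.query, h.stack]
    exact h.out
  · constructor <;>
      simp [Acc.insert, hc, not_le.2 hx1, h.flag, h.zero, h.one, h.two, h.sp, h.op, h.p₁, h.c₁,
        h.x₁, h.p₂, h.x₂, hlt, h.query, h.stack]
    exact h.out

theorem wp_flushCode {Q : State → Prop} {s : State} {q : Fin 9 → ℝ}
    {st : List Tree} {A : Acc} {x : ℝ}
    (h : Searching D q s st A) (hT : (Tree.flush x).Rep D (s.word 6))
    (hw : 2 * A.out.length + 4 ≤ D.workWords)
    (hQ : ∀ s', Searching D q s' st (A.flush x) → Q s') :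
    flushCode.wp δ D Q s := by
  obtain ⟨-, hx⟩ := hT
  have hlt : ∀ i : Fin 9, (i : ℕ) ≠ 9 ∧ (i : ℕ) ≠ 10 ∧ (i : ℕ) ≠ 11 ∧ (i : ℕ) ≠ 12 ∧
      (i : ℕ) ≠ 13 := by decide
  simp only [flushCode, block, Program.wp, Instr.wp]
  simp only [State.setWord_word, State.setReal_real, State.setWord_real,
    State.setWorkWord_word, State.setWorkWord_real, h.op, h.two, h.p₁, h.p₂]
  norm_num
  refine ⟨by omega, by omega, x, by simpa using hx, ?_⟩
  apply hQ
  constructor <;>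
    simp [Acc.flush, h.flag, h.zero, h.one, h.two, h.sp, hlt, h.query]
  · omega
  -- Both stores go to odd cells, hence miss the stack.
  · exact h.stack.congr fun i hi => by simp; split_ifs <;> omega
  · intro i hi
    rcases lt_trichotomy i A.out.length with hi' | hi' | hi'
    · rw [if_neg (by omega), if_neg (by omega), h.out i hi', List.getElem_append_left hi']
    · subst hi'
      rw [if_neg (by omega), if_pos rfl]
      simp
    · obtain rfl : i = A.out.length + 1 := by omega
      rw [if_pos (by ring)]
      simp

open Classical in
/-- The effect of the visit of a node on the stack. -/
noncomputable def Tree.children (q : Fin 9 → ℝ) : Tree → List Tree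
  | .branch v c a b e => if v ≤ c ⬝ᵥ q then [a, b] else [e]
  | _ => []

/-- The effect of the visit of a node on the accumulator. -/
noncomputable def Tree.update : Tree → Acc → Acc
  | .insert pt col x, A => A.insert pt col x
  | .flush x, A => A.flush x
  | _, A => A

theorem wp_visitCode {Q : State → Prop} {s : State} {q : Fin 9 → ℝ}
    {st : List Tree} {A : Acc} {T : Tree} (h : Searching D q s (T :: st) A)
    (hw : 2 * (st.length + 2) ≤ D.workWords) (hw' : 2 * A.out.length + 4 ≤ D.workWords)
    (hQ : ∀ s', Searching D q s' (T.children q ++ st) (T.update A) → Q s') :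
    visitCode.wp δ D Q s := by
  obtain ⟨hT, hst⟩ := h.stack
  have key : ∀ k, D.words[s.workWord (2 * st.length)]? = some k →
      (∀ s', Searching D q s' st A → s'.word 6 = s.workWord (2 * st.length) → s'.word 7 = k →
        (Program.ite (.eqWord 7 1) branchCode (.ite (.eqWord 7 2) insertCode
          (.ite (.eqWord 7 3) flushCode .skip))).wp δ D Q s') → visitCode.wp δ D Q s := by
    intro k hk hs
    have hsp : s.word 4 - 2 = 2 * st.length := by rw [h.sp]; simp; omega
    simp only [visitCode, block]
    rw [Program.wp]
    -- Only the straight-line prefix is unfolded, so that the case distinction on the kind of node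
    -- stays in the form required by `hs`.
    simp only [Program.wp.eq_2, Program.wp.eq_3, Program.wp.eq_1, Instr.wp]
    refine ⟨by simp [h.two, hsp]; omega, k, by simpa [h.two, hsp] using hk, ?_⟩
    apply hs
    · constructor <;>
        simp [hsp, h.flag, h.zero, h.one, h.two, h.p₁, h.c₁, h.x₁, h.p₂, h.x₂, h.op, h.query, hst]
      exact h.out
    · simp [h.two, hsp]
    · simp
  cases T with
  | nil =>
    refine key 3 hT fun s' hs' h6 h7 => ?_
    simp only [Program.wp, Test.Holds, h7, hs'.zero, hs'.one, hs'.two]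
    norm_num
    exact hQ _ hs'
  | insert pt col x =>
    refine key 1 hT.1 fun s' hs' h6 h7 => ?_
    simp only [Program.wp, Test.Holds, h7, hs'.zero, hs'.one, hs'.two]
    norm_num
    exact wp_insertCode hs' (by rw [h6]; exact hT) hQ
  | flush x =>
    refine key 2 hT.1 fun s' hs' h6 h7 => ?_
    simp only [Program.wp, Test.Holds, h7, hs'.zero, hs'.one, hs'.two]
    norm_num
    exact wp_flushCode hs' (by rw [h6]; exact hT) hw' hQ
  | branch v c a b e =>
    refine key 0 hT.1 fun s' hs' h6 h7 => ?_
    simp only [Program.wp, Test.Holds, h7, hs'.zero, hs'.one, hs'.two]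
    norm_num
    refine wp_branchCode hs' (by rw [h6]; exact hT) hw (fun ht s₂ hs₂ => hQ _ ?_)
      (fun ht s₂ hs₂ => hQ _ ?_)
    · simpa [Tree.children, Tree.update, ht] using hs₂
    · simpa only [Tree.children, Tree.update, ht, if_false, List.singleton_append] using hs₂

/-- Processing a list of trees. -/
noncomputable def processAll (q : Fin 9 → ℝ) (st : List Tree) (A : Acc) : Acc :=
  st.foldl (fun A T => T.process q A) A

/-- The loop invariant of the traversal: the result still to be computed from stack and accumulator
does not change when a node is visited. -/
theorem processAll_children (q : Fin 9 → ℝ) (T : Tree) (st : List Tree) (A : Acc) :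
    processAll q (T.children q ++ st) (T.update A) = processAll q (T :: st) A := by
  cases T with
  | branch v c a b e =>
    by_cases h : v ≤ c ⬝ᵥ q <;> simp [processAll, Tree.children, Tree.update, Tree.process, h]
  | _ => simp [processAll, Tree.children, Tree.update, Tree.process]

/-- The termination measure: the total number of visits owed by the stack drops by exactly one. -/
theorem visits_children (q : Fin 9 → ℝ) (T : Tree) :
    ((T.children q).map (Tree.visits q)).sum + 1 = T.visits q := by
  cases T with
  | branch v c a b e =>
    by_cases h : v ≤ c ⬝ᵥ q <;> simp [Tree.children, Tree.visits, h] <;> omega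
  | _ => simp [Tree.children, Tree.visits]

theorem length_update (T : Tree) (A : Acc) : (T.update A).out.length ≤ A.out.length + 2 := by
  cases T with
  | insert pt col x => simp only [Tree.update, Acc.insert]; split_ifs <;> simp
  | _ => simp [Tree.update, Acc.flush]

theorem length_le_visits (q : Fin 9 → ℝ) (st : List Tree) :
    st.length ≤ (st.map (Tree.visits q)).sum := by
  induction st with
  | nil => simp
  | cons T st ih => have := T.visits_pos q; simp; omega

/-- Each visit outputs at most two pointers, so the memory requirement, stated with the remaining
number `n` of visits, is preserved. It also bounds the stack, since every stacked tree owes at least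
one visit. -/
theorem runs_searchCode {q : Fin 9 → ℝ} (n : ℕ) {s : State} {st : List Tree} {A : Acc}
    (hn : (st.map (Tree.visits q)).sum = n) (h : Searching D q s st A)
    (hw : 2 * (A.out.length + 2 * n) + 2 ≤ D.workWords) :
    Runs δ D searchCode s (n * (1 + visitCode.cost) + 1)
      (fun s' => Searching D q s' [] (processAll q st A)) := by
  induction n generalizing s st A with
  | zero =>
    have hl := length_le_visits q st
    obtain rfl : st = [] := List.eq_nil_of_length_eq_zero (by omega)
    rw [Nat.zero_mul, Nat.zero_add]
    exact Runs.while_false (by simp [Test.Holds, h.zero, h.sp]) h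
  | succ n ih =>
    cases st with
    | nil => simp at hn
    | cons T st =>
      have hl := length_le_visits q st
      have hc := visits_children q T
      have hv := T.visits_pos q
      have hu := length_update T A
      simp only [List.map_cons, List.sum_cons] at hn
      refine (Runs.while_true (T₁ := visitCode.cost) (T₂ := n * (1 + visitCode.cost) + 1)
        (by simp [Test.Holds, h.zero, h.sp]) (Runs.of_wp ?_)).mono
        (Q := fun s' => Searching D q s' [] (processAll q (T :: st) A)) (by rw [Nat.succ_mul]; omega)
        fun _ h' => h'
      refine wp_visitCode h (by omega) (by omega) fun s' hs' => ?_
      rw [← processAll_children]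
      exact ih (by rw [List.map_append, List.sum_append]; omega) hs' (by omega)

/-! ### The scan of all pairs of candidates

Word registers: 14, 15 addresses of the current candidates, 16, 17 and 18, 21 their pointers and
colours, 22 the result of the check of the current pair.
Real registers: 13-15 and 16-18 the current pair, 19 its distance, 20 the smallest distance so far,
21-26 the pair attaining it. -/

/-- Load the point whose pointer is in the working memory at `w idx`. -/
def loadPoint (idx ptr col base : ℕ) : Program :=
  block [.loadWord ptr idx, .readWord col ptr, .readReal base ptr, .addWord 8 ptr 2,
    .readReal (base + 1) 8, .addWord 8 8 2, .readReal (base + 2) 8]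

def need (c : Test) : Program := .ite c .skip (.instr (.copyWord 22 1))

def checkCoord (k : ℕ) : Program :=
  .seq (.seq (need (.leReal k (13 + k))) (need (.leReal (13 + k) (3 + k))))
    (.seq (.seq (need (.leReal k (16 + k))) (need (.leReal (16 + k) (3 + k))))
      (.ite (.leReal (13 + k) (6 + k))
        (.ite (.leReal (6 + k) (16 + k)) .skip (need (.leReal (6 + k) (13 + k))))
        (need (.leReal (16 + k) (6 + k)))))

def checkCode : Program := .seq (checkCoord 0) (.seq (checkCoord 1) (checkCoord 2))

def recordCode : Program :=
  block [.copyWord 0 2, .copyReal 20 19, .copyReal 21 13, .copyReal 22 14, .copyReal 23 15,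
    .copyReal 24 16, .copyReal 25 17, .copyReal 26 18]

/-- The colours are compared first; then register 22 is set to 1 and survives only if both points
are in the box and the pair is anchored. The inner pointer has already been advanced, so every
branch is ready for the next round. -/
def pairCode : Program :=
  .seq (loadPoint 15 18 21 16) (.seq (.instr (.addWord 15 15 3)) (.ite (.eqWord 17 21) .skip
    (.seq (.instr (.copyWord 22 2)) (.seq checkCode (.ite (.eqWord 22 2)
      (.seq (.instr (.dist 19 (fun i => 13 + i) (fun i => 16 + i)))
        (.ite (.eqWord 0 1) recordCode (.ite (.leReal 20 19) .skip recordCode))) .skip)))))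

def innerCode : Program := .while (.ltWord 15 5) pairCode

def outerHead : Program :=
  .seq (loadPoint 14 16 17 13) (block [.addWord 14 14 3, .copyWord 15 2])

def scanCode : Program := .while (.ltWord 14 5) (.seq outerHead innerCode)

/-! ### Verification of the scan -/

open Classical in
/-- `p` clears the flag in register 22 unless `P` holds. -/
def IsCheck (δ : Point → Point → ℝ) (D : DataStructure) (p : Program) (P : (ℕ → ℝ) → Prop) : Prop :=
  ∀ (s : State) (Q : State → Prop), Q (if P s.real then s else s.setWord 22 (s.word 1)) →
    p.wp δ D Q s

theorem isCheck_need (a b : ℕ) : IsCheck δ D (need (.leReal a b)) fun r => r a ≤ r b := by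
  intro s Q h
  refine ⟨fun hc => ?_, fun hc => ?_⟩
  all_goals
    simp only [Test.Holds] at hc
    simpa [Program.wp, Instr.wp, hc] using h

/-- A check touches no real register and clearing the flag is idempotent, so consecutive checks
amount to a conjunction. -/
theorem IsCheck.seq {p p' : Program} {P P' : (ℕ → ℝ) → Prop} (h : IsCheck δ D p P)
    (h' : IsCheck δ D p' P') : IsCheck δ D (.seq p p') fun r => P r ∧ P' r := by
  intro s Q hQ
  apply h
  apply h'
  by_cases h1 : P s.real <;> by_cases h2 : P' s.real <;> simp [h1, h2] at hQ ⊢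
  · exact hQ
  · exact hQ
  · exact hQ
  · have : ((s.setWord 22 (s.word 1)).setWord 22 (s.word 1)) = s.setWord 22 (s.word 1) := by
      simp [State.setWord]
    rwa [this]

theorem IsCheck.congr {p : Program} {P P' : (ℕ → ℝ) → Prop} (h : IsCheck δ D p P)
    (hP : ∀ r, P r ↔ P' r) : IsCheck δ D p P' := by
  obtain rfl : P = P' := funext fun r => propext (hP r)
  exact h

theorem IsCheck.ite {p p' : Program} {a b : ℕ} {P P' : (ℕ → ℝ) → Prop} (h : IsCheck δ D p P)
    (h' : IsCheck δ D p' P') : IsCheck δ D (.ite (.leReal a b) p p')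
      fun r => (r a ≤ r b → P r) ∧ (¬ r a ≤ r b → P' r) := by
  intro s Q hQ
  refine ⟨fun hc => h _ _ ?_, fun hc => h' _ _ ?_⟩ <;> simp only [Test.Holds] at hc
  · have : ((s.real a ≤ s.real b → P s.real) ∧ (¬ s.real a ≤ s.real b → P' s.real)) ↔ P s.real := by
      tauto
    by_cases hp : P s.real
    · rw [if_pos hp]; rwa [if_pos (this.2 hp)] at hQ
    · rw [if_neg hp]; rwa [if_neg (mt this.1 hp)] at hQ
  · have : ((s.real a ≤ s.real b → P s.real) ∧ (¬ s.real a ≤ s.real b → P' s.real)) ↔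
        P' s.real := by tauto
    by_cases hp : P' s.real
    · rw [if_pos hp]; rwa [if_pos (this.2 hp)] at hQ
    · rw [if_neg hp]; rwa [if_neg (mt this.1 hp)] at hQ

theorem isCheck_skip : IsCheck δ D .skip fun _ => True := by
  intro s Q h
  simpa [Program.wp] using h

/-- What has to hold in the coordinate `k`. -/
def CoordOk (k : ℕ) (r : ℕ → ℝ) : Prop :=
  (r k ≤ r (13 + k) ∧ r (13 + k) ≤ r (3 + k)) ∧ (r k ≤ r (16 + k) ∧ r (16 + k) ≤ r (3 + k)) ∧
    min (r (13 + k)) (r (16 + k)) ≤ r (6 + k) ∧ r (6 + k) ≤ max (r (13 + k)) (r (16 + k))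

theorem isCheck_checkCoord (k : ℕ) : IsCheck δ D (checkCoord k) (CoordOk k) := by
  refine (((isCheck_need _ _).seq (isCheck_need _ _)).seq
    (((isCheck_need _ _).seq (isCheck_need _ _)).seq
      ((isCheck_skip.ite (isCheck_need _ _)).ite (isCheck_need _ _)))).congr fun r => ?_
  unfold CoordOk
  refine and_congr_right fun _ => and_congr_right fun _ => ?_
  grind

theorem isCheck_checkCode :
    IsCheck δ D checkCode fun r => CoordOk 0 r ∧ CoordOk 1 r ∧ CoordOk 2 r :=
  (isCheck_checkCoord 0).seq ((isCheck_checkCoord 1).seq (isCheck_checkCoord 2))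

/-- The point `a` with the colour number `c` is stored at the address `p`. -/
def PointAt (D : DataStructure) (p : ℕ) (a : Point) (c : ℕ) : Prop :=
  D.words[p]? = some c ∧ ∀ k : Fin 3, D.reals[p + k]? = some (a k)

/-- The state `s` holds the query and the candidates `cand`. -/
structure Scanning (D : DataStructure) (cw : Point → ℕ) (l u o : Point) (cand : List Point)
    (s : State) : Prop where
  query : s.HasQuery l u o
  zero : s.word 1 = 0
  one : s.word 2 = 1
  two : s.word 3 = 2
  op : s.word 5 = 2 * cand.length + 1
  mem : ∀ i (h : i < cand.length),
    PointAt D (s.workWord (2 * i + 1)) cand[i] (cw cand[i])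
  bound : 2 * cand.length + 1 ≤ D.workWords

theorem Scanning.congr {cw : Point → ℕ} {l u o : Point} {cand : List Point} {s s' : State}
    (h : Scanning D cw l u o cand s) (hr : ∀ i < 9, s'.real i = s.real i)
    (h1 : s'.word 1 = s.word 1) (h2 : s'.word 2 = s.word 2) (h3 : s'.word 3 = s.word 3)
    (h5 : s'.word 5 = s.word 5) (hm : s'.workWord = s.workWord) :
    Scanning D cw l u o cand s' where
  query i := by
    rw [hr _ (by omega), hr _ (by omega), hr _ (by omega)]
    exact h.query i
  zero := by rw [h1, h.zero]
  one := by rw [h2, h.one]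
  two := by rw [h3, h.two]
  op := by rw [h5, h.op]
  mem := by rw [hm]; exact h.mem
  bound := h.bound

/-- The recorded pair. -/
def State.recorded (s : State) : Point × Point :=
  (fun i => s.real (21 + i), fun i => s.real (24 + i))

/-- The recorded pair is the best one of `X ∩ Pi`. -/
def Best (δ : Point → Point → ℝ) (Pi X : Set (Point × Point)) (s : State) : Prop :=
  (s.word 0 = 0 ∧ ∀ φ ∈ X, φ ∉ Pi) ∨
    (s.word 0 = 1 ∧ s.recorded ∈ Pi ∧ s.real 20 = δ s.recorded.1 s.recorded.2 ∧
      ∀ φ ∈ X, φ ∈ Pi → δ s.recorded.1 s.recorded.2 ≤ δ φ.1 φ.2)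

theorem Best.congr {Pi X : Set (Point × Point)} {s s' : State} (h : Best δ Pi X s)
    (h0 : s'.word 0 = s.word 0) (hr : ∀ i, 20 ≤ i → s'.real i = s.real i) : Best δ Pi X s' := by
  have : s'.recorded = s.recorded := by
    simp only [State.recorded]
    congr 1 <;> funext i <;> exact hr _ (by omega)
  unfold Best
  rwa [this, h0, hr 20 le_rfl]

theorem Best.insert_notMem {Pi X : Set (Point × Point)} {s : State} {φ : Point × Point}
    (h : Best δ Pi X s) (hφ : φ ∉ Pi) : Best δ Pi (insert φ X) s := by
  rcases h with ⟨h0, h⟩ | ⟨h0, h1, h2, h⟩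
  · refine Or.inl ⟨h0, ?_⟩
    rintro ψ (rfl | hψ)
    exacts [hφ, h _ hψ]
  · refine Or.inr ⟨h0, h1, h2, ?_⟩
    rintro ψ (rfl | hψ) hP
    exacts [absurd hP hφ, h _ hψ hP]

theorem wp_loadPoint {idx ptr col base : ℕ} {p c : ℕ} {a : Point} {Q : State → Prop} {s : State}
    (hp : s.workWord (s.word idx) = p) (hi : s.word idx < D.workWords) (h2 : s.word 2 = 1)
    (ha : PointAt D p a c) (hne : ptr ≠ 2 ∧ ptr ≠ 8 ∧ col ≠ 2 ∧ col ≠ 8 ∧ ptr ≠ col)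
    (hQ : ∀ s' : State, (∀ x, x ≠ ptr → x ≠ col → x ≠ 8 → s'.word x = s.word x) → s'.word col = c →
      (∀ x, x ≠ base → x ≠ base + 1 → x ≠ base + 2 → s'.real x = s.real x) →
      (∀ k : Fin 3, s'.real (base + k) = a k) → s'.workWord = s.workWord → Q s') :
    (loadPoint idx ptr col base).wp δ D Q s := by
  obtain ⟨n1, n2, n3, n4, n5⟩ := hne
  obtain ⟨hc, hr⟩ := ha
  have r0 := hr 0
  have r1 := hr 1
  have r2 := hr 2
  simp only [loadPoint, block, Program.wp, Instr.wp]
  refine ⟨hi, c, by simpa [hp] using hc, a 0, by simpa [hp, n5] using r0, a 1, ?_, a 2, ?_, ?_⟩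
  · simpa [hp, n5, h2, n1.symm, n2, n3.symm, n4] using r1
  · simpa [hp, n5, h2, n1.symm, n2, n3.symm, n4] using r2
  · apply hQ
    · intro x hx1 hx2 hx3
      simp [hx1, hx2, hx3]
    · simp [n4]
    · intro x hx1 hx2 hx3
      simp [hx1, hx2, hx3]
    · intro k
      fin_cases k <;> simp
    · simp

/-- The pairs in `Pi` can be recognised by the check. -/
def Recognisable (cw : Point → ℕ) (l u o : Point) (a b : Point) (Pi : Set (Point × Point)) : Prop :=
  (a, b) ∈ Pi ↔ cw a ≠ cw b ∧ ∀ k : Fin 3, (l k ≤ a k ∧ a k ≤ u k) ∧ (l k ≤ b k ∧ b k ≤ u k) ∧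
    min (a k) (b k) ≤ o k ∧ o k ≤ max (a k) (b k)

theorem wp_recordCode {Pi X : Set (Point × Point)} {a b : Point} {Q : State → Prop} {s : State}
    (h2 : s.word 2 = 1) (ha : ∀ k : Fin 3, s.real (13 + k) = a k)
    (hb : ∀ k : Fin 3, s.real (16 + k) = b k) (hd : s.real 19 = δ a b) (hP : (a, b) ∈ Pi)
    (hX : ∀ φ ∈ X, φ ∈ Pi → δ a b ≤ δ φ.1 φ.2)
    (hQ : ∀ s' : State, (∀ x, x ≠ 0 → s'.word x = s.word x) → (∀ x < 19, s'.real x = s.real x) →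
      s'.workWord = s.workWord → Best δ Pi (insert (a, b) X) s' → Q s') :
    recordCode.wp δ D Q s := by
  simp only [recordCode, block, Program.wp, Instr.wp]
  apply hQ
  · intro x hx
    simp [hx]
  · intro x hx
    simp only [State.setReal_real, State.setWord_real]
    repeat rw [if_neg (by omega)]
  · rfl
  · have a0 := ha 0
    have a1 := ha 1
    have a2 := ha 2
    have b0 := hb 0
    have b1 := hb 1
    have b2 := hb 2
    simp at a0 a1 a2 b0 b1 b2
    refine Or.inr ?_
    generalize hs' : State.setReal _ 26 _ = s'
    have hrec : s'.recorded = (a, b) := by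
      subst hs'
      simp only [State.recorded]
      congr 1 <;> funext i <;> fin_cases i <;> simp [a0, a1, a2, b0, b1, b2]
    rw [hrec]
    refine ⟨by subst hs'; simp [h2], hP, by subst hs'; simp [hd], ?_⟩
    rintro φ (rfl | hφ) hφP
    exacts [le_rfl, hX φ hφ hφP]

/-- The set `X` of pairs already examined grows by one. A pair outside `Pi` leaves the record
optimal; a pair in `Pi` is recorded exactly if there is no record yet or it is strictly closer. -/
theorem wp_pairCode {cw : Point → ℕ} {l u o : Point} {cand : List Point}
    {Pi X : Set (Point × Point)} {a : Point} {j : ℕ} {Q : State → Prop} {s : State}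
    (h : Scanning D cw l u o cand s) (hB : Best δ Pi X s) (hj : j < cand.length)
    (h15 : s.word 15 = 2 * j + 1) (h17 : s.word 17 = cw a)
    (ha : ∀ k : Fin 3, s.real (13 + k) = a k) (hR : Recognisable cw l u o a cand[j] Pi)
    (hQ : ∀ s' : State, Scanning D cw l u o cand s' → Best δ Pi (insert (a, cand[j]) X) s' →
      s'.word 14 = s.word 14 → s'.word 15 = 2 * (j + 1) + 1 → s'.word 17 = cw a →
      (∀ k : Fin 3, s'.real (13 + k) = a k) → Q s') :
    pairCode.wp δ D Q s := by
  have hbd := h.bound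
  rw [pairCode, Program.wp]
  refine wp_loadPoint rfl (by rw [h15]; omega) h.one (by rw [h15]; exact h.mem j hj) (by decide)
    fun s₁ w₁ c₁ r₁ b₁ m₁ => ?_
  have hS₁ : Scanning D cw l u o cand s₁ := h.congr (fun i hi => r₁ i (by omega) (by omega)
    (by omega)) (w₁ _ (by decide) (by decide) (by decide))
    (w₁ _ (by decide) (by decide) (by decide)) (w₁ _ (by decide) (by decide) (by decide))
    (w₁ _ (by decide) (by decide) (by decide)) m₁
  have hB₁ : Best δ Pi X s₁ := hB.congr (w₁ _ (by decide) (by decide) (by decide))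
    fun i hi => r₁ i (by omega) (by omega) (by omega)
  have hw (x : ℕ) (h1 : x ≠ 18 := by decide) (h2 : x ≠ 21 := by decide) (h3 : x ≠ 8 := by decide) :
      s₁.word x = s.word x := w₁ x h1 h2 h3
  have ha₁ : ∀ k : Fin 3, s₁.real (13 + k) = a k := fun k => by
    rw [r₁ _ (by omega) (by omega) (by omega), ha]
  simp only [Program.wp, Instr.wp]
  set s₂ := s₁.setWord 15 (s₁.word 15 + s₁.word 3) with hs₂
  have hS₂ : Scanning D cw l u o cand s₂ := hS₁.congr (fun _ _ => rfl) (by simp [hs₂])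
    (by simp [hs₂]) (by simp [hs₂]) (by simp [hs₂]) rfl
  have hB₂ : Best δ Pi X s₂ := hB₁.congr (by simp [hs₂]) fun _ _ => rfl
  have h14₂ : s₂.word 14 = s.word 14 := by simp [hs₂, hw]
  have h15₂ : s₂.word 15 = 2 * (j + 1) + 1 := by simp [hs₂, hw, h15, h.two]; ring
  have h17₂ : s₂.word 17 = cw a := by simp [hs₂, hw, h17]
  have h21₂ : s₂.word 21 = cw cand[j] := by simp [hs₂, c₁]
  refine ⟨fun hc => ?_, fun hc => ?_⟩
  · simp only [Test.Holds, h17₂, h21₂] at hc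
    exact hQ _ hS₂ (hB₂.insert_notMem fun hm => (hR.1 hm).1 hc) h14₂ h15₂ h17₂ ha₁
  simp only [Test.Holds, h17₂, h21₂] at hc
  apply isCheck_checkCode
  set s₃ := s₂.setWord 22 (s₂.word 2) with hs₃
  have hiff : (CoordOk 0 s₃.real ∧ CoordOk 1 s₃.real ∧ CoordOk 2 s₃.real) ↔
      (a, cand[j]) ∈ Pi := by
    unfold Recognisable at hR
    have hall : (CoordOk 0 s₃.real ∧ CoordOk 1 s₃.real ∧ CoordOk 2 s₃.real) ↔
        ∀ k : Fin 3, CoordOk k s₃.real := by simp [Fin.forall_fin_succ]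
    rw [hR, hall]
    simp only [hc, ne_eq, not_false_iff, true_and]
    refine forall_congr' fun k => ?_
    have hq := hS₁.query k
    have hr : s₃.real = s₁.real := rfl
    rw [CoordOk, hr, ha₁, b₁, hq.1, hq.2.1, hq.2.2]
  by_cases hP : (a, cand[j]) ∈ Pi
  · rw [if_pos (hiff.2 hP)]
    refine ⟨fun _ => ?_, fun h' => absurd (by simp [Test.Holds, hs₃]) h'⟩
    set s₄ := s₃.setReal 19 (δ (fun i => s₃.real (13 + i)) (fun i => s₃.real (16 + i))) with hs₄
    have hd : s₄.real 19 = δ a cand[j] := by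
      have e1 : (fun i : Fin 3 => s₃.real (13 + i)) = a := funext ha₁
      have e2 : (fun i : Fin 3 => s₃.real (16 + i)) = cand[j] := funext b₁
      rw [hs₄, e1, e2]
      simp
    have hr₄ : ∀ x, x ≠ 19 → s₄.real x = s₁.real x := fun x hx => by
      simp only [hs₄, State.setReal_real, if_neg hx]; rfl
    have hw₄ : ∀ x, x ≠ 22 → s₄.word x = s₂.word x := fun x hx => by
      simp [hs₄, hs₃, hx]
    have hS₄ : Scanning D cw l u o cand s₄ := hS₂.congr (fun i hi => hr₄ i (by omega))
      (hw₄ _ (by decide)) (hw₄ _ (by decide)) (hw₄ _ (by decide)) (hw₄ _ (by decide)) rfl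
    have hB₄ : Best δ Pi X s₄ := hB₂.congr (hw₄ _ (by decide)) fun i hi => hr₄ i (by omega)
    have ha₄ : ∀ k : Fin 3, s₄.real (13 + k) = a k := fun k => by rw [hr₄ _ (by omega), ha₁]
    have hb₄ : ∀ k : Fin 3, s₄.real (16 + k) = cand[j] k := fun k => by rw [hr₄ _ (by omega), b₁]
    have fin : (∀ φ ∈ X, φ ∈ Pi → δ a cand[j] ≤ δ φ.1 φ.2) → recordCode.wp δ D Q s₄ := fun hX => by
      refine wp_recordCode hS₄.one ha₄ hb₄ hd hP hX fun s₅ w₅ r₅ m₅ hB₅ => ?_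
      refine hQ _ (hS₄.congr (fun i hi => r₅ i (by omega)) (w₅ _ (by decide)) (w₅ _ (by decide))
        (w₅ _ (by decide)) (w₅ _ (by decide)) m₅) hB₅ ?_ ?_ ?_ ?_
      · rw [w₅ _ (by decide), hw₄ _ (by decide), h14₂]
      · rw [w₅ _ (by decide), hw₄ _ (by decide), h15₂]
      · rw [w₅ _ (by decide), hw₄ _ (by decide), h17₂]
      · intro k
        rw [r₅ _ (by omega), ha₄]
    refine ⟨fun h0 => fin ?_, fun h0 => ⟨fun hle => ?_, fun hle => fin ?_⟩⟩
    · simp only [Test.Holds, hS₄.zero] at h0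
      rcases hB₄ with ⟨_, hX⟩ | ⟨h1, _⟩
      · exact fun φ hφ hφP => absurd hφP (hX φ hφ)
      · omega
    · simp only [Test.Holds, hS₄.zero] at h0
      simp only [Test.Holds, hd] at hle
      refine hQ _ hS₄ ?_ (by rw [hw₄ _ (by decide), h14₂]) (by rw [hw₄ _ (by decide), h15₂])
        (by rw [hw₄ _ (by decide), h17₂]) ha₄
      rcases hB₄ with ⟨h1, hX⟩ | ⟨h1, h2, h3, h4⟩
      · omega
      · refine Or.inr ⟨h1, h2, h3, ?_⟩
        rintro φ (rfl | hφ) hφP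
        · rwa [h3] at hle
        · exact h4 φ hφ hφP
    · simp only [Test.Holds, hS₄.zero] at h0
      simp only [Test.Holds, hd] at hle
      rcases hB₄ with ⟨h1, hX⟩ | ⟨h1, h2, h3, h4⟩
      · omega
      · rw [h3] at hle
        exact fun φ hφ hφP => (not_le.1 hle).le.trans (h4 φ hφ hφP)
  · rw [if_neg fun h' => hP (hiff.1 h')]
    refine ⟨fun h' => ?_, fun _ => ?_⟩
    · simp [Test.Holds, hs₃, hS₂.zero, hS₂.one] at h'
    · refine hQ _ (hS₂.congr (fun _ _ => rfl) (by simp [hs₃]) (by simp [hs₃]) (by simp [hs₃])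
        (by simp [hs₃]) rfl) ((hB₂.insert_notMem hP).congr (by simp [hs₃]) fun _ _ => rfl)
        (by simp [hs₃, h14₂]) (by simp [hs₃, h15₂]) (by simp [hs₃, h17₂]) ha₁

theorem runs_innerCode {cw : Point → ℕ} {l u o : Point} {cand : List Point}
    {Pi : Set (Point × Point)} {a : Point} (hR : ∀ b ∈ cand, Recognisable cw l u o a b Pi) (n : ℕ)
    {X : Set (Point × Point)} {j : ℕ} {s : State} (hn : j + n = cand.length)
    (h : Scanning D cw l u o cand s) (hB : Best δ Pi X s)
    (h15 : s.word 15 = 2 * j + 1) (h17 : s.word 17 = cw a)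
    (ha : ∀ k : Fin 3, s.real (13 + k) = a k) :
    Runs δ D innerCode s (n * (1 + pairCode.cost) + 1) fun s' =>
      Scanning D cw l u o cand s' ∧ s'.word 14 = s.word 14 ∧
        Best δ Pi (X ∪ {φ | φ.1 = a ∧ φ.2 ∈ cand.drop j}) s' := by
  induction n generalizing X j s with
  | zero =>
    rw [Nat.zero_mul, Nat.zero_add]
    refine Runs.while_false (by simp only [Test.Holds, h15, h.op]; omega) ⟨h, rfl, ?_⟩
    rw [List.drop_eq_nil_of_le (by omega)]
    simpa using hB
  | succ n ih =>
    have hj : j < cand.length := by omega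
    have hset : X ∪ {φ : Point × Point | φ.1 = a ∧ φ.2 ∈ cand.drop j} =
        insert (a, cand[j]) X ∪ {φ | φ.1 = a ∧ φ.2 ∈ cand.drop (j + 1)} := by
      rw [List.drop_eq_getElem_cons hj]
      ext ⟨x, y⟩
      simp only [Set.mem_union, Set.mem_ofPred_eq, Set.mem_insert_iff, List.mem_cons, Prod.mk.injEq]
      tauto
    rw [hset]
    refine (Runs.while_true (T₁ := pairCode.cost) (T₂ := n * (1 + pairCode.cost) + 1)
      (by simp only [Test.Holds, h15, h.op]; omega) (Runs.of_wp (wp_pairCode h hB hj h15 h17 ha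
        (hR _ (List.getElem_mem hj)) fun s' hS' hB' h14' h15' h17' ha' => ?_))).mono
        (by rw [Nat.succ_mul]; omega) fun _ h' => h'
    rw [← h14']
    exact ih (by omega) hS' hB' h15' h17' ha'

/-- The running time bound of the scan of `m` candidates. -/
def scanTime (m : ℕ) : ℕ := m * (1 + (outerHead.cost + (m * (1 + pairCode.cost) + 1))) + 1

theorem runs_scanCode_aux {cw : Point → ℕ} {l u o : Point} {cand : List Point}
    {Pi : Set (Point × Point)} (hR : ∀ a ∈ cand, ∀ b ∈ cand, Recognisable cw l u o a b Pi) (n : ℕ)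
    {X : Set (Point × Point)} {i : ℕ} {s : State} (hn : i + n = cand.length)
    (h : Scanning D cw l u o cand s) (hB : Best δ Pi X s) (h14 : s.word 14 = 2 * i + 1) :
    Runs δ D scanCode s
      (n * (1 + (outerHead.cost + (cand.length * (1 + pairCode.cost) + 1))) + 1) fun s' =>
        Best δ Pi (X ∪ {φ | φ.1 ∈ cand.drop i ∧ φ.2 ∈ cand}) s' := by
  induction n generalizing X i s with
  | zero =>
    rw [Nat.zero_mul, Nat.zero_add]
    refine Runs.while_false (by simp only [Test.Holds, h14, h.op]; omega) ?_
    rw [List.drop_eq_nil_of_le (by omega)]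
    simpa using hB
  | succ n ih =>
    have hi : i < cand.length := by omega
    have hset : X ∪ {φ : Point × Point | φ.1 ∈ cand.drop i ∧ φ.2 ∈ cand} =
        (X ∪ {φ | φ.1 = cand[i] ∧ φ.2 ∈ cand.drop 0}) ∪
          {φ | φ.1 ∈ cand.drop (i + 1) ∧ φ.2 ∈ cand} := by
      rw [List.drop_eq_getElem_cons hi]
      ext ⟨x, y⟩
      simp only [Set.mem_union, Set.mem_ofPred_eq, List.mem_cons, List.drop_zero]
      tauto
    rw [hset]
    set T := cand.length * (1 + pairCode.cost) + 1
    refine (Runs.while_true (T₁ := outerHead.cost + T)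
      (T₂ := n * (1 + (outerHead.cost + T)) + 1)
      (by simp only [Test.Holds, h14, h.op]; omega) (Runs.seq (Runs.of_wp ?_))).mono
        (by rw [Nat.succ_mul]; omega) fun _ h' => h'
    have hbd := h.bound
    rw [outerHead, Program.wp]
    refine wp_loadPoint rfl (by rw [h14]; omega) h.one (by rw [h14]; exact h.mem i hi) (by decide)
      fun s₁ w₁ c₁ r₁ b₁ m₁ => ?_
    have hw (x : ℕ) (h1 : x ≠ 16 := by decide) (h2 : x ≠ 17 := by decide)
        (h3 : x ≠ 8 := by decide) : s₁.word x = s.word x := w₁ x h1 h2 h3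
    simp only [block, Program.wp, Instr.wp]
    generalize hs₂ : State.setWord _ 15 _ = s₂
    have w₂ : ∀ x, x ≠ 14 → x ≠ 15 → s₂.word x = s₁.word x := fun x h1 h2 => by
      simp [← hs₂, h1, h2]
    have r₂ : s₂.real = s₁.real := by simp [← hs₂]
    have m₂ : s₂.workWord = s.workWord := by simp [← hs₂, m₁]
    have h14₂ : s₂.word 14 = 2 * (i + 1) + 1 := by simp [← hs₂, hw, h14, h.two]; ring
    have h15₂ : s₂.word 15 = 2 * 0 + 1 := by simp [← hs₂, hw, h.one]
    have hS₂ : Scanning D cw l u o cand s₂ := h.congr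
      (fun i hi => by rw [r₂, r₁ i (by omega) (by omega) (by omega)])
      (by rw [w₂ _ (by decide) (by decide), hw _]) (by rw [w₂ _ (by decide) (by decide), hw _])
      (by rw [w₂ _ (by decide) (by decide), hw _]) (by rw [w₂ _ (by decide) (by decide), hw _]) m₂
    have hB₂ : Best δ Pi X s₂ := hB.congr (by rw [w₂ _ (by decide) (by decide), hw _])
      fun i hi => by rw [r₂, r₁ i (by omega) (by omega) (by omega)]
    refine (runs_innerCode (hR _ (List.getElem_mem hi)) cand.length (Nat.zero_add _) hS₂ hB₂ h15₂
      (by rw [w₂ _ (by decide) (by decide), c₁]) (fun k => by rw [r₂, b₁])).mono le_rfl ?_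
    rintro s₃ ⟨hS₃, h14₃, hB₃⟩
    exact ih (by omega) hS₃ hB₃ (by rw [h14₃, h14₂])

theorem runs_scanCode {cw : Point → ℕ} {l u o : Point} {cand : List Point}
    {Pi : Set (Point × Point)} (hR : ∀ a ∈ cand, ∀ b ∈ cand, Recognisable cw l u o a b Pi)
    {s : State} (h : Scanning D cw l u o cand s) (h0 : s.word 0 = 0) (h14 : s.word 14 = 1) :
    Runs δ D scanCode s (scanTime cand.length) fun s' =>
        Best δ Pi {φ | φ.1 ∈ cand ∧ φ.2 ∈ cand} s' := by
  have := runs_scanCode_aux (δ := δ) (X := ∅) hR cand.length (i := 0) (by omega) h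
    (Or.inl ⟨h0, by simp⟩) (by simpa using h14)
  simpa [scanTime] using this

/-! ### The query program -/

/-- Register 2 holds 1, so the read fetches the root address from cell 1. It becomes the only stack
entry, at cell 0; the output starts at cell 1. -/
def startCode : Program :=
  block [.constWord 0 0, .constWord 1 0, .constWord 2 1, .constWord 3 2, .readWord 9 2,
    .storeWord 1 9, .constWord 4 2, .constWord 5 1, .constWord 10 0, .constWord 11 0,
    .constReal 11 0, .constWord 12 0, .constReal 12 0]

def displayCode : Program :=
  block [.copyReal 0 21, .copyReal 1 22, .copyReal 2 23, .copyReal 3 24, .copyReal 4 25,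
    .copyReal 5 26]

/-- The query program. -/
def queryProgram : Program :=
  .seq startCode (.seq searchCode (.seq (.instr (.copyWord 14 2)) (.seq scanCode displayCode)))

/-- The accumulator at the start. -/
def Acc.start : Acc := ⟨0, 0, 0, 0, 0, []⟩

def queryVector (l u o : Point) : Fin 9 → ℝ :=
  ![l 0, l 1, l 2, u 0, u 1, u 2, o 0, o 1, o 2]

theorem wp_startCode {l u o : Point} {T : Tree} {p : ℕ} {Q : State → Prop} {s : State}
    (hq : s.HasQuery l u o) (hp : D.words[1]? = some p) (hT : T.Rep D p) (hw : 0 < D.workWords)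
    (hQ : ∀ s', Searching D (queryVector l u o) s' [T] Acc.start → Q s') :
    startCode.wp δ D Q s := by
  simp only [startCode, block, Program.wp, Instr.wp]
  refine ⟨p, by simpa using hp, by simpa using hw, ?_⟩
  apply hQ
  have q0 := hq 0
  have q1 := hq 1
  have q2 := hq 2
  simp at q0 q1 q2
  constructor <;> simp [Acc.start, StackRep, hT]
  intro i
  fin_cases i <;> simp [queryVector, q0, q1, q2]

/-- The time bound of a query with `v` visits and `m` candidates. -/
def queryTime (v m : ℕ) : ℕ :=
  startCode.cost + (v * (1 + visitCode.cost) + 1 + (1 + (scanTime m + displayCode.cost)))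

theorem runs_queryProgram {l u o : Point} {T : Tree} {p : ℕ} {s : State} {cw : Point → ℕ}
    {cand : List Point} {Pi : Set (Point × Point)}
    (hq : s.HasQuery l u o) (hp : D.words[1]? = some p) (hT : T.Rep D p)
    (hw : 4 * T.visits (queryVector l u o) + 2 ≤ D.workWords)
    (hw' : 2 * cand.length + 1 ≤ D.workWords)
    (hlen : (T.process (queryVector l u o) Acc.start).out.length = cand.length)
    (hc : ∀ i (h : i < cand.length) (h' : i < (T.process (queryVector l u o) Acc.start).out.length),
      PointAt D (T.process (queryVector l u o) Acc.start).out[i] cand[i] (cw cand[i]))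
    (hR : ∀ a ∈ cand, ∀ b ∈ cand, Recognisable cw l u o a b Pi) :
    Runs δ D queryProgram s (queryTime (T.visits (queryVector l u o)) cand.length) fun s' =>
      (s'.word 0 = 0 ∧ ∀ a ∈ cand, ∀ b ∈ cand, (a, b) ∉ Pi) ∨
      (s'.word 0 = 1 ∧ s'.outputPair ∈ Pi ∧ ∀ a ∈ cand, ∀ b ∈ cand, (a, b) ∈ Pi →
        δ s'.outputPair.1 s'.outputPair.2 ≤ δ a b) := by
  refine Runs.seq (Runs.of_wp (wp_startCode hq hp hT (by omega) fun s₁ hs₁ => Runs.seq ?_))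
  refine (runs_searchCode (T.visits (queryVector l u o)) (by simp) hs₁
    (by simp [Acc.start]; omega)).mono le_rfl fun s₂ hs₂ => Runs.seq (Runs.of_wp (p := .instr _) ?_)
  have hA : processAll (queryVector l u o) [T] Acc.start =
    T.process (queryVector l u o) Acc.start := rfl
  rw [hA] at hs₂
  simp only [Program.wp, Instr.wp]
  have hS : Scanning D cw l u o cand (s₂.setWord 14 (s₂.word 2)) := by
    refine Scanning.congr (s := s₂) ⟨fun i => ?_, hs₂.zero, hs₂.one, hs₂.two, by rw [hs₂.op, hlen],
      fun i hi => ?_, hw'⟩ (fun _ _ => rfl) (by simp) (by simp) (by simp) (by simp) rfl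
    · have e1 := hs₂.query ⟨i, by omega⟩
      have e2 := hs₂.query ⟨3 + i, by omega⟩
      have e3 := hs₂.query ⟨6 + i, by omega⟩
      simp only at e1 e2 e3
      rw [e1, e2, e3]
      fin_cases i <;> simp [queryVector]
    · rw [hs₂.out i (by omega)]
      exact hc i hi (by omega)
  refine Runs.seq ((runs_scanCode hR hS (by simp [hs₂.flag]) (by simp [hs₂.one])).mono le_rfl
    fun s₃ hB => Runs.of_wp ?_)
  simp only [displayCode, block, Program.wp, Instr.wp]
  generalize hs₄ : State.setReal _ 5 _ = s₄
  have hw₄ : s₄.word = s₃.word := by simp [← hs₄]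
  have ho : s₄.outputPair = s₃.recorded := by
    simp only [State.outputPair, State.recorded]
    congr 1 <;> funext i <;> fin_cases i <;> simp [← hs₄]
  rw [hw₄, ho]
  rcases hB with ⟨h0, h⟩ | ⟨h0, h1, -, h⟩
  · exact Or.inl ⟨h0, fun a ha b hb => h _ ⟨ha, hb⟩⟩
  · exact Or.inr ⟨h0, h1, fun a ha b hb => h _ ⟨ha, hb⟩⟩

/-! ### Range trees -/

/-- The accumulator describes the set `X`: it holds a point minimising `g` over `X` and one
minimising `g` over the points of `X` of another colour, with placeholders of value `v`. -/
structure Covers (ptr col : Point → ℕ) (g : Point → ℝ) (v : ℝ) (X : Set Point) (A : Acc) :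
    Prop where
  le₁ : ∀ p ∈ X, A.x₁ ≤ g p
  le₂ : ∀ p ∈ X, col p ≠ A.c₁ → A.x₂ ≤ g p
  mem₁ : (∃ a ∈ X, A.p₁ = ptr a ∧ A.c₁ = col a ∧ A.x₁ = g a) ∨ (A.p₁ = 0 ∧ A.c₁ = 0 ∧ A.x₁ = v)
  mem₂ : (∃ a ∈ X, A.p₂ = ptr a ∧ col a ≠ A.c₁ ∧ A.x₂ = g a) ∨ (A.p₂ = 0 ∧ A.x₂ = v)

variable {ptr col : Point → ℕ} {g : Point → ℝ} {v : ℝ} {X : Set Point} {A : Acc}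

theorem covers_flush (A : Acc) : Covers ptr col g v ∅ (A.flush v) :=
  ⟨by simp, by simp, Or.inr ⟨rfl, rfl, rfl⟩, Or.inr ⟨rfl, rfl⟩⟩

/-- The delicate case is a new minimum of a new colour: the former minimum becomes the second entry.
It bounds all of the old set, in particular the points that differ in colour from the new minimum.
-/
theorem Covers.insert (h : Covers ptr col g v X A) (p : Point) (hp : col p ≠ 0) :
    Covers ptr col g v (insert p X) (A.insert (ptr p) (col p) (g p)) := by
  have m1 : (∃ a ∈ Insert.insert p X, A.p₁ = ptr a ∧ A.c₁ = col a ∧ A.x₁ = g a) ∨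
      (A.p₁ = 0 ∧ A.c₁ = 0 ∧ A.x₁ = v) :=
    h.mem₁.imp_left fun ⟨a, ha, h'⟩ => ⟨a, Or.inr ha, h'⟩
  have m2 : (∃ a ∈ Insert.insert p X, A.p₂ = ptr a ∧ col a ≠ A.c₁ ∧ A.x₂ = g a) ∨
      (A.p₂ = 0 ∧ A.x₂ = v) :=
    h.mem₂.imp_left fun ⟨a, ha, h'⟩ => ⟨a, Or.inr ha, h'⟩
  unfold Acc.insert
  split_ifs with hc h1 h1 h2
  · refine ⟨?_, ?_, m1, m2⟩
    · rintro x (rfl | hx)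
      exacts [h1, h.le₁ x hx]
    · rintro x (rfl | hx) hne
      exacts [absurd hc hne, h.le₂ x hx hne]
  · refine ⟨?_, ?_, Or.inl ⟨p, Or.inl rfl, rfl, hc.symm, rfl⟩, m2⟩
    · rintro x (rfl | hx)
      exacts [le_rfl, (not_le.1 h1).le.trans (h.le₁ x hx)]
    · rintro x (rfl | hx) hne
      exacts [absurd hc hne, h.le₂ x hx hne]
  · refine ⟨?_, ?_, m1, m2⟩
    · rintro x (rfl | hx)
      exacts [h1, h.le₁ x hx]
    · rintro x (rfl | hx) hne
      exacts [h2, h.le₂ x hx hne]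
  · refine ⟨?_, ?_, m1, Or.inl ⟨p, Or.inl rfl, rfl, hc, rfl⟩⟩
    · rintro x (rfl | hx)
      exacts [h1, h.le₁ x hx]
    · rintro x (rfl | hx) hne
      exacts [le_rfl, (not_le.1 h2).le.trans (h.le₂ x hx hne)]
  · refine ⟨?_, ?_, Or.inl ⟨p, Or.inl rfl, rfl, rfl, rfl⟩, ?_⟩
    · rintro x (rfl | hx)
      exacts [le_rfl, (not_le.1 h1).le.trans (h.le₁ x hx)]
    · rintro x (rfl | hx) hne
      exacts [absurd rfl hne, h.le₁ x hx]
    · rcases m1 with ⟨a, ha, e1, e2, e3⟩ | ⟨e1, e2, e3⟩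
      · exact Or.inl ⟨a, ha, e1, fun h' => hc (e2 ▸ h'.symm), e3⟩
      · exact Or.inr ⟨e1, e3⟩

theorem Covers.mono {Y : Set Point} (h : Covers ptr col g v X A) (hXY : X ⊆ Y)
    (h1 : ∀ p ∈ Y, A.x₁ ≤ g p) (h2 : ∀ p ∈ Y, col p ≠ A.c₁ → A.x₂ ≤ g p) :
    Covers ptr col g v Y A :=
  ⟨h1, h2, h.mem₁.imp_left fun ⟨a, ha, h'⟩ => ⟨a, hXY ha, h'⟩,
    h.mem₂.imp_left fun ⟨a, ha, h'⟩ => ⟨a, hXY ha, h'⟩⟩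

/-- The two points of an accumulator replace a point `a` of `X`: there is one of the same colour,
or there are two of different colours. -/
theorem Covers.select (h : Covers ptr col g v X A) (hv : ∀ p ∈ X, g p < v) {a : Point}
    (ha : a ∈ X) :
    ∃ b ∈ X, ∃ c ∈ X, (A.p₁ = ptr b ∨ A.p₂ = ptr b) ∧ (A.p₁ = ptr c ∨ A.p₂ = ptr c) ∧
      g b ≤ g a ∧ g c ≤ g a ∧ (col b = col a ∨ col b ≠ col c) := by
  rcases h.mem₁ with ⟨b, hb, e1, e2, e3⟩ | ⟨-, -, e⟩
  · have hle := h.le₁ a ha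
    by_cases hc : col a = A.c₁
    · exact ⟨b, hb, b, hb, Or.inl e1, Or.inl e1, e3 ▸ hle, e3 ▸ hle, Or.inl (by rw [hc, e2])⟩
    · have hle2 := h.le₂ a ha hc
      rcases h.mem₂ with ⟨c, hc', f1, f2, f3⟩ | ⟨-, e⟩
      · exact ⟨b, hb, c, hc', Or.inl e1, Or.inr f1, e3 ▸ hle, f3 ▸ hle2,
          Or.inr fun h' => f2 (by rw [e2, h'])⟩
      · exact absurd (hv a ha) (not_lt.2 (e ▸ hle2))
  · exact absurd (hv a ha) (not_lt.2 (e ▸ h.le₁ a ha))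

/-- Two accumulators replace a bichromatic pair. -/
theorem Covers.select_pair {g' : Point → ℝ} {v' : ℝ} {Y : Set Point} {B : Acc}
    (h : Covers ptr col g v X A) (h' : Covers ptr col g' v' Y B) (hv : ∀ p ∈ X, g p < v)
    (hv' : ∀ p ∈ Y, g' p < v') {a b : Point} (ha : a ∈ X) (hb : b ∈ Y) (hab : col a ≠ col b) :
    ∃ c ∈ X, ∃ d ∈ Y, (A.p₁ = ptr c ∨ A.p₂ = ptr c) ∧ (B.p₁ = ptr d ∨ B.p₂ = ptr d) ∧
      col c ≠ col d ∧ g c ≤ g a ∧ g' d ≤ g' b := by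
  obtain ⟨c, hc, c', hc', m, m', l, l', e⟩ := h.select hv ha
  obtain ⟨d, hd, d', hd', n, n', k, k', f⟩ := h'.select hv' hb
  by_cases h1 : col c = col d
  · rcases e with e | e
    · rcases f with f | f
      · exact absurd (e ▸ f ▸ h1) hab
      · exact ⟨c, hc, d', hd', m, n', h1 ▸ f, l, k'⟩
    · exact ⟨c', hc', d, hd, m', n, fun h2 => e (h1.trans h2.symm), l', k⟩
  · exact ⟨c, hc, d, hd, m, n, h1, l, k⟩

/-- All words in the `insert` nodes are at most `B`. -/
def Tree.Bounded (B : ℕ) : Tree → Prop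
  | .nil => True
  | .insert pt col _ => pt ≤ B ∧ col ≤ B
  | .flush _ => True
  | .branch _ _ a b e => a.Bounded B ∧ b.Bounded B ∧ e.Bounded B

/-- A constraint bounds a function on points by a linear functional of the query. -/
abbrev Constraint : Type := (Point → ℝ) × (Fin 9 → ℝ)

/-- The points satisfying all constraints for the query `q`. -/
def satisfying (cs : List Constraint) (q : Fin 9 → ℝ) : Set Point :=
  {p | ∀ c ∈ cs, c.1 p ≤ c.2 ⬝ᵥ q}

/-- `T` merges the points of `S` that satisfy the constraints into the accumulator. -/
structure IsRangeTree (ptr col : Point → ℕ) (g : Point → ℝ) (B : ℕ) (cs : List Constraint)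
    (S : Finset Point) (T : Tree) : Prop where
  covers : ∀ v q X A, Covers ptr col g v X A →
    Covers ptr col g v (X ∪ (↑S ∩ satisfying cs q)) (T.process q A)
  out : ∀ q A, (T.process q A).out = A.out
  bounded : T.Bounded B

theorem Acc.insert_out (A : Acc) (p c : ℕ) (x : ℝ) : (A.insert p c x).out = A.out := by
  unfold Acc.insert
  split_ifs <;> rfl

/-- Visit both trees. -/
def Tree.fork (a b : Tree) : Tree := .branch 0 0 a b .nil

@[simp] theorem Tree.process_fork (a b : Tree) (q : Fin 9 → ℝ) (A : Acc) :
    (Tree.fork a b).process q A = b.process q (a.process q A) := by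
  simp [Tree.fork, Tree.process]

@[simp] theorem Tree.visits_fork (a b : Tree) (q : Fin 9 → ℝ) :
    (Tree.fork a b).visits q = 1 + (a.visits q + b.visits q) := by
  simp [Tree.fork, Tree.visits]

@[simp] theorem Tree.size_fork (a b : Tree) : (Tree.fork a b).size = 2 + a.size + b.size := by
  simp [Tree.fork, Tree.size]; ring

/-- Removing minima one at a time allows a split of prescribed size even when values coincide. -/
theorem exists_lower_part {α : Type*} [DecidableEq α] (f : α → ℝ) (S : Finset α) (k : ℕ)
    (hk : k ≤ S.card) :
    ∃ lo ⊆ S, lo.card = k ∧ ∀ a ∈ lo, ∀ b ∈ S \ lo, f a ≤ f b := by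
  induction k with
  | zero => exact ⟨∅, by simp, rfl, by simp⟩
  | succ k ih =>
    obtain ⟨lo, hlo, hc, h⟩ := ih (by omega)
    have hne : (S \ lo).Nonempty := by
      rw [← Finset.card_pos, Finset.card_sdiff_of_subset hlo]; omega
    obtain ⟨m, hm, hmin⟩ := Finset.exists_min_image (S \ lo) f hne
    rw [Finset.mem_sdiff] at hm
    refine ⟨insert m lo, Finset.insert_subset hm.1 hlo, by rw [Finset.card_insert_of_notMem hm.2, hc],
      ?_⟩
    intro a ha b hb
    have hb' : b ∈ S \ lo := by
      simp only [Finset.mem_sdiff, Finset.mem_insert] at hb ⊢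
      tauto
    rcases Finset.mem_insert.1 ha with rfl | ha
    exacts [hmin b hb', h a ha b hb']

variable {B : ℕ}

/-! ### Construction of the range trees -/

/-- Without constraints all of `S` is merged, and for this only two of its points matter: a minimum,
and a minimum among the points of another colour, if there is any. -/
theorem exists_rangeTree_nil (S : Finset Point) (hS : S.Nonempty)
    (hB : ∀ p ∈ S, ptr p ≤ B ∧ col p ≤ B) (hcol : ∀ p ∈ S, col p ≠ 0) :
    ∃ T : Tree, IsRangeTree ptr col g B [] S T ∧ T.size ≤ 4 ∧ ∀ q, T.visits q ≤ 3 := by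
  classical
  obtain ⟨a, ha, hmin⟩ := Finset.exists_min_image S g hS
  by_cases hne : (S.filter fun p => col p ≠ col a).Nonempty
  · obtain ⟨b, hb, hbmin⟩ := Finset.exists_min_image _ g hne
    rw [Finset.mem_filter] at hb
    refine ⟨.fork (.insert (ptr a) (col a) (g a)) (.insert (ptr b) (col b) (g b)), ⟨?_, ?_, ?_⟩,
      by simp [Tree.size], by simp [Tree.visits]⟩
    · intro v q X A h
      have h' := (h.insert a (hcol a ha)).insert b (hcol b hb.1)
      rw [Tree.process_fork, Tree.process, Tree.process]
      have hsat : ∀ p, p ∈ X ∪ (↑S ∩ satisfying [] q) ↔ p ∈ X ∨ p ∈ S := by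
        simp [satisfying]
      refine h'.mono ?_ ?_ ?_
      · rintro p (rfl | rfl | hp) <;> rw [hsat]
        exacts [Or.inr hb.1, Or.inr ha, Or.inl hp]
      · intro p hp
        rcases (hsat p).1 hp with hp | hp
        · exact h'.le₁ p (Or.inr (Or.inr hp))
        · exact (h'.le₁ a (Or.inr (Or.inl rfl))).trans (hmin p hp)
      · intro p hp hc
        rcases (hsat p).1 hp with hp | hp
        · exact h'.le₂ p (Or.inr (Or.inr hp)) hc
        -- If the winning colour is that of `a`, then `b` bounds the points of all other colours;
        -- otherwise `a` itself competes for the second entry and bounds everything.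
        · by_cases hca : col a = ((A.insert (ptr a) (col a) (g a)).insert (ptr b) (col b) (g b)).c₁
          · exact (h'.le₂ b (Or.inl rfl) (by rw [← hca]; exact hb.2)).trans
              (hbmin p (Finset.mem_filter.2 ⟨hp, by rw [hca]; exact hc⟩))
          · exact (h'.le₂ a (Or.inr (Or.inl rfl)) hca).trans (hmin p hp)
    · intro q A
      simp [Tree.process, Acc.insert_out]
    · simp [Tree.fork, Tree.Bounded, hB a ha, hB b hb.1]
  · refine ⟨.insert (ptr a) (col a) (g a), ⟨?_, ?_, ?_⟩, by simp [Tree.size], by simp [Tree.visits]⟩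
    · intro v q X A h
      have h' := h.insert a (hcol a ha)
      have hsat : ∀ p, p ∈ X ∪ (↑S ∩ satisfying [] q) ↔ p ∈ X ∨ p ∈ S := by
        simp [satisfying]
      have hca : ∀ p ∈ S, col p = col a := fun p hp => by
        by_contra hc
        exact hne ⟨p, Finset.mem_filter.2 ⟨hp, hc⟩⟩
      refine h'.mono ?_ ?_ ?_
      · rintro p (rfl | hp) <;> rw [hsat]
        exacts [Or.inr ha, Or.inl hp]
      · intro p hp
        rcases (hsat p).1 hp with hp | hp
        · exact h'.le₁ p (Or.inr hp)
        · exact (h'.le₁ a (Or.inl rfl)).trans (hmin p hp)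
      · intro p hp hc
        rcases (hsat p).1 hp with hp | hp
        · exact h'.le₂ p (Or.inr hp) hc
        · exact (h'.le₂ a (Or.inl rfl) (hca p hp ▸ hc)).trans (hmin p hp)
    · intro q A
      simp [Tree.process, Acc.insert_out]
    · simp [Tree.Bounded, hB a ha]

theorem satisfying_cons (c : Constraint) (cs : List Constraint) (q : Fin 9 → ℝ) :
    satisfying (c :: cs) q = {p | c.1 p ≤ c.2 ⬝ᵥ q} ∩ satisfying cs q := by
  ext p
  simp [satisfying]

/-- A leaf of a level of a range tree. -/
theorem IsRangeTree.leaf {c : Constraint} {cs : List Constraint} {T : Tree} {p : Point}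
    (h : IsRangeTree ptr col g B cs {p} T) :
    IsRangeTree ptr col g B (c :: cs) {p} (.branch (c.1 p) c.2 T .nil .nil) := by
  refine ⟨fun v q X A hA => ?_, fun q A => ?_, ?_⟩
  · rw [satisfying_cons]
    by_cases hc : c.1 p ≤ c.2 ⬝ᵥ q
    · simp only [Tree.process, hc, if_true]
      convert h.covers v q X A hA using 2
      ext x
      simp only [Finset.coe_singleton, Set.mem_inter_iff, Set.mem_singleton_iff, Set.mem_ofPred_eq]
      constructor
      · rintro ⟨rfl, -, hx⟩; exact ⟨rfl, hx⟩
      · rintro ⟨rfl, hx⟩; exact ⟨rfl, hc, hx⟩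
    · simp only [Tree.process, hc, if_false]
      convert hA using 1
      rw [Set.union_eq_left]
      rintro x ⟨hx, hx', -⟩
      simp only [Finset.coe_singleton, Set.mem_singleton_iff] at hx
      subst hx
      exact absurd hx' hc
  · simp only [Tree.process]
    split_ifs
    exacts [h.out q A, rfl]
  · exact ⟨h.bounded, trivial, trivial⟩

/-- An inner node of a level of a range tree. -/
theorem IsRangeTree.node {c : Constraint} {cs : List Constraint} {S lo hi : Finset Point}
    {T Tlo Thi : Tree} {t : ℝ} (hS : ∀ p, p ∈ S ↔ p ∈ lo ∨ p ∈ hi)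
    (hlo : ∀ p ∈ lo, c.1 p ≤ t) (hhi : ∀ p ∈ hi, t ≤ c.1 p)
    (h : IsRangeTree ptr col g B cs lo T) (h₁ : IsRangeTree ptr col g B (c :: cs) lo Tlo)
    (h₂ : IsRangeTree ptr col g B (c :: cs) hi Thi) :
    IsRangeTree ptr col g B (c :: cs) S (.branch t c.2 T Thi Tlo) := by
  refine ⟨fun v q X A hA => ?_, fun q A => ?_, ?_⟩
  · by_cases hc : t ≤ c.2 ⬝ᵥ q
    · simp only [Tree.process, hc, if_true]
      convert h₂.covers v q _ _ (h.covers v q X A hA) using 1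
      ext x
      simp only [satisfying_cons, Set.mem_union, Set.mem_inter_iff, Finset.mem_coe, hS,
        Set.mem_ofPred_eq]
      have := fun hx => (hlo x hx).trans hc
      tauto
    · simp only [Tree.process, hc, if_false]
      convert h₁.covers v q _ _ hA using 1
      ext x
      simp only [satisfying_cons, Set.mem_union, Set.mem_inter_iff, Finset.mem_coe, hS,
        Set.mem_ofPred_eq]
      have := fun hx (hx' : c.1 x ≤ c.2 ⬝ᵥ q) => hc ((hhi x hx).trans hx')
      tauto
  · simp only [Tree.process]
    split_ifs
    · rw [h₂.out, h.out]
    · rw [h₁.out]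
  · exact ⟨h.bounded, h₂.bounded, h₁.bounded⟩

/-- Sort by the first constraint and halve. If the upper half's smallest value passes, all of the
lower half passes, so it is left to a tree for the remaining constraints and the search continues in
the upper half; otherwise the upper half fails and the search continues in the lower half. As the
constraints are one-sided, a single path is followed on each level, which costs one factor `L + 1`
per constraint. The base tree contributes the 5 and each leaf level at most 3 more nodes; the `+ 1`
on the left absorbs the inner nodes. -/
theorem exists_rangeTree (cs : List Constraint) (L : ℕ) (S : Finset Point) (hS : S.Nonempty)
    (hL : S.card ≤ 2 ^ L) (hB : ∀ p ∈ S, ptr p ≤ B ∧ col p ≤ B) (hcol : ∀ p ∈ S, col p ≠ 0) :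
    ∃ T : Tree, IsRangeTree ptr col g B cs S T ∧
      T.size + 1 ≤ (3 * cs.length + 5) * S.card * (L + 1) ^ cs.length ∧
      ∀ q, T.visits q + 1 ≤ (3 * cs.length + 5) * (L + 1) ^ cs.length := by
  classical
  induction cs generalizing L S with
  | nil =>
    obtain ⟨T, hT, hs, hv⟩ := exists_rangeTree_nil (g := g) S hS hB hcol
    have := hS.card_pos
    refine ⟨T, hT, by simp; omega, fun q => ?_⟩
    have := hv q
    simp; omega
  | cons c cs ihc =>
    simp only [List.length_cons]
    generalize cs.length = m at ihc ⊢
    induction L generalizing S with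
    | zero =>
      have hc1 : S.card = 1 := le_antisymm (by simpa using hL) hS.card_pos
      obtain ⟨p, rfl⟩ := Finset.card_eq_one.1 hc1
      obtain ⟨T, hT, hs, hv⟩ := ihc 0 {p} hS hL hB hcol
      refine ⟨_, hT.leaf (c := c), ?_, fun q => ?_⟩
      · simp [Tree.size] at hs ⊢; omega
      · have := hv q
        simp only [Tree.visits]
        simp at this ⊢
        split_ifs <;> omega
    | succ L ih =>
      have hpow : ∀ k : ℕ, (L + 1) ^ k ≤ (L + 1 + 1) ^ k := fun k =>
        Nat.pow_le_pow_left (by omega) k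
      by_cases hcard : S.card ≤ 2 ^ L
      · obtain ⟨T, hT, hs, hv⟩ := ih S hS hcard hB hcol
        exact ⟨T, hT, hs.trans (Nat.mul_le_mul_left _ (hpow _)),
          fun q => (hv q).trans (Nat.mul_le_mul_left _ (hpow _))⟩
      -- The lower part gets exactly `2 ^ L` points, which leaves at most `2 ^ L` for the upper one.
      · obtain ⟨lo, hloS, hloc, hle⟩ := exists_lower_part c.1 S (2 ^ L) (by omega)
        have hsd := Finset.card_sdiff_of_subset hloS
        rw [pow_succ] at hL
        have hne : (S \ lo).Nonempty := by
          rw [← Finset.card_pos]; omega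
        have hlone : lo.Nonempty := by
          rw [← Finset.card_pos, hloc]; positivity
        obtain ⟨b, hb, hbmin⟩ := Finset.exists_min_image _ c.1 hne
        have hBlo : ∀ p ∈ lo, ptr p ≤ B ∧ col p ≤ B := fun p hp => hB p (hloS hp)
        have hclo : ∀ p ∈ lo, col p ≠ 0 := fun p hp => hcol p (hloS hp)
        obtain ⟨T, hT, hs, hv⟩ := ihc L lo hlone hloc.le hBlo hclo
        obtain ⟨T₁, hT₁, hs₁, hv₁⟩ := ih lo hlone hloc.le hBlo hclo
        obtain ⟨T₂, hT₂, hs₂, hv₂⟩ := ih (S \ lo) hne (by omega)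
          (fun p hp => hB p (Finset.mem_sdiff.1 hp).1) (fun p hp => hcol p (Finset.mem_sdiff.1 hp).1)
        have hmem : ∀ p, p ∈ S ↔ p ∈ lo ∨ p ∈ S \ lo := fun p => by
          rw [Finset.mem_sdiff]
          have := @hloS p
          tauto
        refine ⟨_, hT.node hmem (fun p hp => hle p hp b hb) hbmin hT₁ hT₂, ?_, fun q => ?_⟩
        · have hSc : lo.card + (S \ lo).card = S.card := by omega
          have e : (L + 1 + 1) ^ (m + 1) = (L + 1 + 1) ^ m * (L + 1 + 1) := pow_succ _ _
          have e' : (L + 1) ^ (m + 1) = (L + 1) ^ m * (L + 1) := pow_succ _ _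
          have hP := hpow m
          rw [e'] at hs₁ hs₂
          rw [e, ← hSc]
          set a := lo.card
          set b := (S \ lo).card
          set P := (L + 1) ^ m
          set P' := (L + 1 + 1) ^ m
          simp only [Tree.size]
          calc 1 + T.size + T₂.size + T₁.size + 1
              ≤ (3 * m + 5) * a * P + ((3 * (m + 1) + 5) * b * (P * (L + 1)) +
                (3 * (m + 1) + 5) * a * (P * (L + 1))) := by omega
            _ ≤ (3 * (m + 1) + 5) * (a + b) * P + ((3 * (m + 1) + 5) * b * (P * (L + 1)) +
                (3 * (m + 1) + 5) * a * (P * (L + 1))) := by gcongr <;> omega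
            _ = (3 * (m + 1) + 5) * (a + b) * (P * (L + 1 + 1)) := by ring
            _ ≤ _ := by gcongr
        · have e : (L + 1 + 1) ^ (m + 1) = (L + 1 + 1) ^ m * (L + 1 + 1) := pow_succ _ _
          have e' : (L + 1) ^ (m + 1) = (L + 1) ^ m * (L + 1) := pow_succ _ _
          have hP := hpow m
          have h0 := hv q
          have h1 := hv₁ q
          have h2 := hv₂ q
          rw [e'] at h1 h2
          rw [e]
          set P := (L + 1) ^ m
          set P' := (L + 1 + 1) ^ m
          have hpos : 1 ≤ (3 * m + 5) * P := (by omega : 1 ≤ T.visits q + 1).trans h0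
          simp only [Tree.visits]
          calc _ ≤ (3 * m + 5) * P + (3 * (m + 1) + 5) * (P * (L + 1)) := by split_ifs <;> omega
            _ ≤ (3 * (m + 1) + 5) * P + (3 * (m + 1) + 5) * (P * (L + 1)) := by gcongr; omega
            _ = (3 * (m + 1) + 5) * (P * (L + 1 + 1)) := by ring
            _ ≤ _ := by gcongr

/-! ### Forests -/

/-- The tree that visits all trees `f i`, starting with a new accumulator each time. -/
def chain {ι : Type*} (f : ι → Tree) (v : ι → ℝ) : List ι → Tree
  -- The last flush only outputs the last accumulator; its value is not used for any comparison.
  | [] => .flush 0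
  | i :: l => .fork (.flush (v i)) (.fork (f i) (chain f v l))

variable {ι : Type*} {f : ι → Tree} {vals : ι → ℝ}

/-- The 5 counts two forks of two nodes each and one flush. -/
theorem size_chain {s : ℕ} (l : List ι) (h : ∀ i ∈ l, (f i).size ≤ s) :
    (chain f vals l).size ≤ l.length * (s + 5) + 1 := by
  induction l with
  | nil => simp [chain, Tree.size]
  | cons i l ih =>
    have h1 := h i (by simp)
    have h2 := ih fun j hj => h j (by simp [hj])
    simp only [chain, Tree.size_fork, List.length_cons, Nat.succ_mul, Tree.size]
    omega

theorem visits_chain {s : ℕ} {q : Fin 9 → ℝ} (l : List ι) (h : ∀ i ∈ l, (f i).visits q ≤ s) :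
    (chain f vals l).visits q ≤ l.length * (s + 5) + 1 := by
  induction l with
  | nil => simp [chain, Tree.visits]
  | cons i l ih =>
    have h1 := h i (by simp)
    have h2 := ih fun j hj => h j (by simp [hj])
    simp only [chain, Tree.visits_fork, List.length_cons, Nat.succ_mul, Tree.visits]
    omega

theorem bounded_chain (l : List ι) (h : ∀ i ∈ l, (f i).Bounded B) :
    (chain f vals l).Bounded B := by
  induction l with
  | nil => trivial
  | cons i l ih =>
    exact ⟨trivial, ⟨h i (by simp), ih fun j hj => h j (by simp [hj]), trivial⟩, trivial⟩

/-- A flush outputs the accumulator left by its predecessor, so the result for `i` appears one flush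
later and the initial accumulator is output as well; hence `l.length + 1` pairs of pointers. The
predicate `V` will say that a pointer is the address of a point. -/
theorem process_chain {q : Fin 9 → ℝ} {P : ι → Acc → Prop} {V : ℕ → Prop} (l : List ι) (A : Acc)
    (h : ∀ i ∈ l, ∀ A : Acc, P i ((f i).process q (A.flush (vals i))) ∧
      ((f i).process q (A.flush (vals i))).out = (A.flush (vals i)).out)
    (hV : ∀ i A, P i A → V A.p₁ ∧ V A.p₂) (hA : V A.p₁ ∧ V A.p₂) (hA' : ∀ p ∈ A.out, V p) :
    (∀ p, p ∈ A.out ∨ p = A.p₁ ∨ p = A.p₂ → p ∈ ((chain f vals l).process q A).out) ∧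
      (∀ p ∈ ((chain f vals l).process q A).out, V p) ∧
      ((chain f vals l).process q A).out.length = A.out.length + 2 * (l.length + 1) ∧
      ∀ i ∈ l, ∃ B, P i B ∧ B.p₁ ∈ ((chain f vals l).process q A).out ∧
        B.p₂ ∈ ((chain f vals l).process q A).out := by
  induction l generalizing A with
  | nil =>
    simp only [chain, Tree.process, Acc.flush]
    refine ⟨by simp, ?_, by simp, by simp⟩
    intro p hp
    simp only [List.mem_append, List.mem_cons, List.not_mem_nil, or_false] at hp
    rcases hp with hp | rfl | rfl
    exacts [hA' p hp, hA.1, hA.2]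
  | cons i l ih =>
    obtain ⟨h1, h2⟩ := h i (by simp) A
    have hflush : (A.flush (vals i)).out = A.out ++ [A.p₁, A.p₂] := rfl
    simp only [chain, Tree.process_fork]
    rw [show (Tree.flush (vals i)).process q A = A.flush (vals i) from rfl]
    set A' := (f i).process q (A.flush (vals i))
    rw [hflush] at h2
    obtain ⟨i1, i2, i3, i4⟩ := ih A' (fun j hj => h j (by simp [hj])) (hV i _ h1) (by
      rw [h2]
      intro p hp
      simp only [List.mem_append, List.mem_cons, List.not_mem_nil, or_false] at hp
      rcases hp with hp | rfl | rfl
      exacts [hA' p hp, hA.1, hA.2])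
    refine ⟨fun p hp => i1 p (Or.inl ?_), i2, ?_, ?_⟩
    · rw [h2]
      simpa using hp
    · rw [i3, h2]
      simp; ring
    · intro j hj
      rcases List.mem_cons.1 hj with rfl | hj
      · exact ⟨A', h1, i1 _ (Or.inr (Or.inl rfl)), i1 _ (Or.inr (Or.inr rfl))⟩
      · exact i4 j hj

/-! ### Memory layout -/

/-- A record of ten cells in each array. -/
structure Rec where
  w : Fin 10 → ℕ
  r : Fin 10 → ℝ

def wordsOf (mem : List Rec) : List ℕ := mem.flatMap fun R => List.ofFn R.w

def realsOf (mem : List Rec) : List ℝ := mem.flatMap fun R => List.ofFn R.r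

theorem getElem?_flatMap_ofFn {α β : Type*} {k : ℕ} (f : α → Fin k → β) (l : List α) (i : ℕ) (a : α)
    (h : l[i]? = some a) (j : Fin k) :
    (l.flatMap fun x => List.ofFn (f x))[k * i + j]? = some (f a j) := by
  induction l generalizing i with
  | nil => simp at h
  | cons b l ih =>
    rw [List.flatMap_cons]
    cases i with
    | zero =>
      simp only [List.getElem?_cons_zero, Option.some.injEq] at h
      subst h
      rw [List.getElem?_append_left (by simp)]
      simp
    | succ i =>
      rw [List.getElem?_append_right (by simp; nlinarith [j.isLt])]
      rw [← ih i (by simpa using h)]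
      congr 1
      simp only [List.length_ofFn, Nat.mul_succ]
      omega

theorem length_wordsOf (mem : List Rec) : (wordsOf mem).length = 10 * mem.length := by
  simp [wordsOf, List.length_flatMap, mul_comm]

theorem length_realsOf (mem : List Rec) : (realsOf mem).length = 10 * mem.length := by
  simp [realsOf, List.length_flatMap, mul_comm]

/-- The records of a tree whose root is record number `i`. -/
def encode : Tree → ℕ → List Rec
  | .nil, _ => [⟨![3, 0, 0, 0, 0, 0, 0, 0, 0, 0], 0⟩]
  | .insert pt col x, _ => [⟨![1, pt, col, 0, 0, 0, 0, 0, 0, 0], fun _ => x⟩]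
  | .flush x, _ => [⟨![2, 0, 0, 0, 0, 0, 0, 0, 0, 0], fun _ => x⟩]
  | .branch v c a b e, i =>
      ⟨![0, 10 * (i + 1), 10 * (i + 1 + a.size), 10 * (i + 1 + a.size + b.size), 0, 0, 0, 0, 0, 0],
        Fin.cons v c⟩ ::
      (encode a (i + 1) ++ (encode b (i + 1 + a.size) ++ encode e (i + 1 + a.size + b.size)))

theorem length_encode (T : Tree) (i : ℕ) : (encode T i).length = T.size := by
  induction T generalizing i with
  | branch v c a b e iha ihb ihe => simp [encode, Tree.size, iha, ihb, ihe]; omega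
  | _ => simp [encode, Tree.size]

theorem cells_encode {D : DataStructure} {mem : List Rec} (hw : D.words = wordsOf mem)
    (hr : D.reals = realsOf mem) {pre tail : List Rec} {R : Rec} (hmem : mem = pre ++ R :: tail) :
    (∀ k : Fin 10, D.words[10 * pre.length + k]? = some (R.w k)) ∧
      ∀ k : Fin 10, D.reals[10 * pre.length + k]? = some (R.r k) := by
  have h : mem[pre.length]? = some R := by
    rw [hmem, List.getElem?_append_right le_rfl]
    simp
  exact ⟨fun k => by rw [hw]; exact getElem?_flatMap_ofFn Rec.w mem _ R h k,
    fun k => by rw [hr]; exact getElem?_flatMap_ofFn Rec.r mem _ R h k⟩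

/-- The records are in preorder, so the children start at offsets given by the sizes of the subtrees
before them. A branch needs ten real cells, one for the threshold and nine for the coefficients,
which is the length of a record. -/
theorem rep_encode {D : DataStructure} {mem : List Rec} (hw : D.words = wordsOf mem)
    (hr : D.reals = realsOf mem) (T : Tree) (i : ℕ) (pre post : List Rec)
    (hmem : mem = pre ++ (encode T i ++ post)) (hi : pre.length = i) : T.Rep D (10 * i) := by
  induction T generalizing i pre post with
  | nil =>
    subst hi
    exact (cells_encode hw hr hmem).1 0
  | insert pt col x =>
    subst hi
    obtain ⟨k1, k2⟩ := cells_encode hw hr hmem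
    exact ⟨k1 0, k1 1, k1 2, k2 0⟩
  | flush x =>
    subst hi
    obtain ⟨k1, k2⟩ := cells_encode hw hr hmem
    exact ⟨k1 0, k2 0⟩
  | branch v c a b e iha ihb ihe =>
    rw [encode] at hmem
    obtain ⟨k1, k2⟩ := cells_encode hw hr hmem
    rw [hi] at k1 k2
    obtain ⟨R, hR⟩ : ∃ R : Rec, mem = pre ++ (R :: (encode a (i + 1) ++
        (encode b (i + 1 + a.size) ++ encode e (i + 1 + a.size + b.size))) ++ post) := ⟨_, hmem⟩
    refine ⟨k1 0, k2 0, fun j => k2 j.succ, ⟨_, k1 1, ?_⟩, ⟨_, k1 2, ?_⟩, ⟨_, k1 3, ?_⟩⟩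
    · refine iha (i + 1) (pre ++ [R])
        (encode b (i + 1 + a.size) ++ (encode e (i + 1 + a.size + b.size) ++ post)) ?_ (by simp [hi])
      rw [hR]
      simp only [List.append_assoc, List.cons_append, List.nil_append]
    · refine ihb (i + 1 + a.size) (pre ++ R :: encode a (i + 1))
        (encode e (i + 1 + a.size + b.size) ++ post) ?_ (by simp [hi, length_encode]; omega)
      rw [hR]
      simp only [List.append_assoc, List.cons_append]
    · refine ihe (i + 1 + a.size + b.size) (pre ++ R :: (encode a (i + 1) ++ encode b (i + 1 + a.size))) post ?_
        (by simp [hi, length_encode]; omega)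
      rw [hR]
      simp only [List.append_assoc, List.cons_append]

theorem encode_word_le {B : ℕ} (T : Tree) (i : ℕ) (hT : T.Bounded B)
    (hB : 10 * (i + T.size) ≤ B) : ∀ R ∈ encode T i, ∀ k, R.w k ≤ B := by
  induction T generalizing i with
  | nil =>
    simp only [Tree.size] at hB
    simp only [encode, List.mem_singleton, forall_eq]
    intro k
    fin_cases k <;> first | omega | (simp; omega) | simp
  | insert pt col x =>
    simp only [Tree.size] at hB
    simp only [encode, List.mem_singleton, forall_eq]
    intro k
    fin_cases k <;> simp [hT.1, hT.2]; omega
  | flush x =>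
    simp only [Tree.size] at hB
    simp only [encode, List.mem_singleton, forall_eq]
    intro k
    fin_cases k <;> first | omega | (simp; omega) | simp
  | branch v c a b e iha ihb ihe =>
    simp only [Tree.size] at hB
    simp only [encode, List.mem_cons, List.mem_append]
    rintro R (rfl | hR | hR | hR) k
    · fin_cases k <;> simp <;> omega
    · exact iha _ hT.1 (by omega) R hR k
    · exact ihb _ hT.2.1 (by omega) R hR k
    · exact ihe _ hT.2.2 (by omega) R hR k

/-- The record of a point, with the address `root` of the tree. -/
def pointRec (cw : Point → ℕ) (root : ℕ) (a : Point) : Rec :=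
  ⟨![cw a, root, 0, 0, 0, 0, 0, 0, 0, 0], ![a 0, a 1, a 2, 0, 0, 0, 0, 0, 0, 0]⟩

/-- All records: first the points, then the tree. -/
def memory (cw : Point → ℕ) (pts : List Point) (T : Tree) : List Rec :=
  pts.map (pointRec cw (10 * pts.length)) ++ encode T pts.length

/-- The data structure storing the points and the tree. -/
def layout (cw : Point → ℕ) (pts : List Point) (T : Tree) (W : ℕ) : DataStructure where
  words := wordsOf (memory cw pts T)
  reals := realsOf (memory cw pts T)
  workWords := W
  workReals := 0

theorem space_layout (cw : Point → ℕ) (pts : List Point) (T : Tree) (W : ℕ) :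
    (layout cw pts T W).space = 20 * (pts.length + T.size) + W := by
  simp only [DataStructure.space, layout, length_wordsOf, length_realsOf, memory, List.length_append,
    List.length_map, length_encode]
  ring

theorem wordSized_layout {cw : Point → ℕ} {pts : List Point} {T : Tree} {W : ℕ}
    (hcw : ∀ a ∈ pts, cw a ≤ pts.length) (hT : T.Bounded (10 * pts.length)) :
    (layout cw pts T W).WordSized := by
  intro w hw
  rw [space_layout]
  simp only [layout, wordsOf, List.mem_flatMap, memory, List.mem_append, List.mem_map] at hw
  obtain ⟨R, hR | hR, hw⟩ := hw
  · obtain ⟨a, ha, rfl⟩ := hR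
    have := hcw a ha
    rw [List.mem_ofFn] at hw
    obtain ⟨k, rfl⟩ := hw
    fin_cases k <;> simp [pointRec] <;> omega
  · rw [List.mem_ofFn] at hw
    obtain ⟨k, rfl⟩ := hw
    have hb : ∀ {B B' : ℕ}, B ≤ B' → ∀ T : Tree, T.Bounded B → T.Bounded B' := fun hBB' T h => by
      induction T with
      | nil => trivial
      | insert pt col x => exact ⟨h.1.trans hBB', h.2.trans hBB'⟩
      | flush x => trivial
      | branch v c a b e iha ihb ihe => exact ⟨iha h.1, ihb h.2.1, ihe h.2.2⟩
    exact encode_word_le T _ (hb (by omega) T hT) (by omega) R hR k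

theorem rep_layout (cw : Point → ℕ) (pts : List Point) (T : Tree) (W : ℕ) :
    T.Rep (layout cw pts T W) (10 * pts.length) :=
  rep_encode rfl rfl T _ (pts.map (pointRec cw (10 * pts.length))) [] (by simp [memory]) (by simp)

theorem cells_point (cw : Point → ℕ) {pts : List Point} (T : Tree) (W : ℕ) {i : ℕ} {a : Point}
    (ha : pts[i]? = some a) :
    (∀ k : Fin 10, (layout cw pts T W).words[10 * i + k]? =
      some ((pointRec cw (10 * pts.length) a).w k)) ∧
      ∀ k : Fin 10, (layout cw pts T W).reals[10 * i + k]? =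
        some ((pointRec cw (10 * pts.length) a).r k) := by
  have hi : i < pts.length := by
    by_contra h
    rw [List.getElem?_eq_none (by omega)] at ha
    simp at ha
  have h : (memory cw pts T)[i]? = some (pointRec cw (10 * pts.length) a) := by
    rw [memory, List.getElem?_append_left (by simpa using hi), List.getElem?_map, ha]
    rfl
  exact ⟨fun k => getElem?_flatMap_ofFn Rec.w _ _ _ h k, fun k => getElem?_flatMap_ofFn Rec.r _ _ _ h k⟩

theorem pointAt_layout (cw : Point → ℕ) {pts : List Point} (T : Tree) (W : ℕ) {i : ℕ} {a : Point}
    (ha : pts[i]? = some a) : PointAt (layout cw pts T W) (10 * i) a (cw a) := by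
  obtain ⟨h1, h2⟩ := cells_point cw T W ha
  refine ⟨h1 0, fun k => ?_⟩
  fin_cases k
  exacts [h2 0, h2 1, h2 2]

/-- Every point record repeats the root address, so it can be found at the fixed cell 1. -/
theorem root_layout (cw : Point → ℕ) {pts : List Point} (T : Tree) (W : ℕ) {a : Point}
    (ha : pts[0]? = some a) : (layout cw pts T W).words[1]? = some (10 * pts.length) :=
  (cells_point cw T W ha).1 1

/-! ### Cells of directions around the anchor -/

/-- The sign of a coordinate in an octant. -/
def sg (σ : Fin 3 → Bool) (i : Fin 3) : ℝ := if σ i then 1 else -1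

theorem sg_cases (σ : Fin 3 → Bool) (i : Fin 3) :
    (σ i = true ∧ sg σ i = 1) ∨ (σ i = false ∧ sg σ i = -1) := by
  cases h : σ i <;> simp [sg, h]

theorem sg_not (σ : Fin 3 → Bool) (i : Fin 3) : sg (fun j => !σ j) i = -sg σ i := by
  cases h : σ i <;> simp [sg, h]

/-- The constraints in the coordinate `j` for the octant `σ`, the main axis `k` and the slope `μ`,
where coordinates have the weights `w`. -/
def axisConstraints (w : Point) (σ : Fin 3 → Bool) (k j : Fin 3) (μ : ℝ) : List Constraint :=
  [(fun p => -(sg σ j * p j), Pi.single ⟨6 + j, by omega⟩ (-sg σ j)),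
    (fun p => sg σ j * p j, Pi.single (if σ j then ⟨3 + j, by omega⟩ else ⟨j, by omega⟩) (sg σ j)),
    (fun p => w j * (sg σ j * p j) - μ * (w k * (sg σ k * p k)),
      Pi.single ⟨6 + j, by omega⟩ (w j * sg σ j) +
        Pi.single ⟨6 + k, by omega⟩ (-(μ * (w k * sg σ k))))]

theorem queryVector_l (l u o : Point) (j : Fin 3) : queryVector l u o ⟨j, by omega⟩ = l j := by
  fin_cases j <;> rfl

theorem queryVector_u (l u o : Point) (j : Fin 3) : queryVector l u o ⟨3 + j, by omega⟩ = u j := by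
  fin_cases j <;> rfl

theorem queryVector_o (l u o : Point) (j : Fin 3) : queryVector l u o ⟨6 + j, by omega⟩ = o j := by
  fin_cases j <;> rfl

/-- The near side of the box needs no constraint of its own: the anchor is inside in this coordinate
and the point lies beyond the anchor. -/
theorem mem_satisfying_axisConstraints {w l u o p : Point} {σ : Fin 3 → Bool} {k j : Fin 3}
    {μ : ℝ} (ho : l j ≤ o j ∧ o j ≤ u j) :
    p ∈ satisfying (axisConstraints w σ k j μ) (queryVector l u o) ↔
      (l j ≤ p j ∧ p j ≤ u j) ∧ 0 ≤ sg σ j * (p j - o j) ∧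
        w j * (sg σ j * (p j - o j)) ≤ μ * (w k * (sg σ k * (p k - o k))) := by
  simp only [satisfying, axisConstraints, List.forall_mem_cons, Set.mem_ofPred_eq,
    List.not_mem_nil, false_implies, implies_true, and_true, add_dotProduct, single_dotProduct,
    queryVector_o]
  have h3 : w j * (sg σ j * p j) - μ * (w k * (sg σ k * p k)) ≤
      w j * sg σ j * o j + -(μ * (w k * sg σ k)) * o k ↔
      w j * (sg σ j * (p j - o j)) ≤ μ * (w k * (sg σ k * (p k - o k))) := by
    constructor <;> intro h <;> linarith
  rw [h3, ← and_assoc, ← and_assoc]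
  refine and_congr_left fun _ => ?_
  rcases sg_cases σ j with ⟨h, hs⟩ | ⟨h, hs⟩
  · rw [hs, h]
    simp only [if_true, queryVector_u]
    constructor
    · rintro ⟨h1, h2⟩; refine ⟨⟨?_, ?_⟩, ?_⟩ <;> linarith
    · rintro ⟨⟨h1, h2⟩, h4⟩; constructor <;> linarith
  · rw [hs, h]
    simp only [Bool.false_eq_true, if_false, queryVector_l]
    constructor
    · rintro ⟨h1, h2⟩; refine ⟨⟨?_, ?_⟩, ?_⟩ <;> linarith
    · rintro ⟨⟨h1, h2⟩, h4⟩; constructor <;> linarith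

/-- The index of a cell: an octant, the main axis, and two slopes. -/
abbrev Cell (N : ℕ) : Type := (Fin 3 → Bool) × Fin 3 × Fin N × Fin N

/-- The constraints describing a cell. -/
noncomputable def cellConstraints (w : Point) {N : ℕ} (t : Cell N) : List Constraint :=
  axisConstraints w t.1 t.2.1 (t.2.1 + 1) (((t.2.2.1 : ℕ) + 1) / N) ++
    axisConstraints w t.1 t.2.1 (t.2.1 + 2) (((t.2.2.2 : ℕ) + 1) / N)

/-- The function to be minimised in a cell. -/
def cellValue {N : ℕ} (t : Cell N) (p : Point) : ℝ := sg t.1 t.2.1 * p t.2.1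

/-- Round `x / y` up to a positive multiple of `1 / N`. -/
theorem exists_slope {N : ℕ} (hN : 0 < N) {x y : ℝ} (hx : 0 ≤ x) (hxy : x ≤ y) :
    ∃ m : Fin N, x ≤ ((m : ℕ) + 1) / N * y ∧ ((m : ℕ) + 1) / N * y ≤ x + y / N := by
  have hN' : (0 : ℝ) < N := by exact_mod_cast hN
  rcases hx.eq_or_lt with rfl | hx
  · refine ⟨⟨0, hN⟩, ?_, ?_⟩
    · simp only [Nat.cast_zero]; positivity
    · simp only [Nat.cast_zero]; apply le_of_eq; ring
  · have hy : 0 < y := hx.trans_le hxy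
    have ht : 0 < N * x / y := by positivity
    have hc : 0 < ⌈N * x / y⌉₊ := Nat.ceil_pos.2 ht
    have hle : ⌈N * x / y⌉₊ ≤ N := by
      rw [Nat.ceil_le, div_le_iff₀ hy]
      gcongr
    obtain ⟨m, hm⟩ := Nat.exists_eq_succ_of_ne_zero hc.ne'
    have h1 := Nat.le_ceil (N * x / y)
    have h2 := Nat.ceil_lt_add_one ht.le
    rw [hm] at h1 h2 hle
    push_cast at h1 h2
    refine ⟨⟨m, hle⟩, ?_, ?_⟩
    · rw [div_le_iff₀ hy] at h1
      rw [div_mul_eq_mul_div, le_div_iff₀ hN']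
      linarith
    · have h3 : ((m : ℝ) + 1) * y ≤ (N * x / y + 1) * y := by gcongr
      rw [add_mul (N * x / y), div_mul_cancel₀ _ hy.ne'] at h3
      rw [div_mul_eq_mul_div, div_le_iff₀ hN', add_mul x, div_mul_cancel₀ _ hN'.ne']
      linarith

/-- For the other axes the slope bound gives offset of `p` ≤ slope × main offset of `p` ≤ slope ×
main offset of `a`, and rounding the slope up cost at most one `N`-th of that main offset. -/
theorem exists_cell {N : ℕ} (hN : 0 < N) {w l u o a : Point} (hw : ∀ i, 0 < w i)
    (σ : Fin 3 → Bool) (ha : ∀ i, 0 ≤ sg σ i * (a i - o i)) (hbox : ∀ i, l i ≤ a i ∧ a i ≤ u i)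
    (ho : ∀ i, l i ≤ o i ∧ o i ≤ u i) :
    ∃ (k : Fin 3) (m₁ m₂ : Fin N),
      a ∈ satisfying (cellConstraints w ((σ, k, m₁, m₂) : Cell N)) (queryVector l u o) ∧
      ∀ p ∈ satisfying (cellConstraints w ((σ, k, m₁, m₂) : Cell N)) (queryVector l u o),
        sg σ k * p k ≤ sg σ k * a k → ∀ i, (l i ≤ p i ∧ p i ≤ u i) ∧ 0 ≤ sg σ i * (p i - o i) ∧
          w i * (sg σ i * (p i - o i)) ≤
            w i * (sg σ i * (a i - o i)) + w k * (sg σ k * (a k - o k)) / N := by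
  have hN' : (0 : ℝ) < N := by exact_mod_cast hN
  set x : Fin 3 → ℝ := fun i => w i * (sg σ i * (a i - o i)) with hx
  have hx0 : ∀ i, 0 ≤ x i := fun i => mul_nonneg (hw i).le (ha i)
  obtain ⟨k, hk⟩ := Finite.exists_max x
  obtain ⟨m₁, h1, h1'⟩ := exists_slope hN (hx0 (k + 1)) (hk _)
  obtain ⟨m₂, h2, h2'⟩ := exists_slope hN (hx0 (k + 2)) (hk _)
  have hmem : ∀ p, p ∈ satisfying (cellConstraints w ((σ, k, m₁, m₂) : Cell N)) (queryVector l u o) ↔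
      p ∈ satisfying (axisConstraints w σ k (k + 1) (((m₁ : ℕ) + 1) / N)) (queryVector l u o) ∧
      p ∈ satisfying (axisConstraints w σ k (k + 2) (((m₂ : ℕ) + 1) / N)) (queryVector l u o) := by
    intro p
    simp only [satisfying, cellConstraints, List.mem_append, Set.mem_ofPred_eq, or_imp, forall_and]
  refine ⟨k, m₁, m₂, ?_, fun p hp hle => ?_⟩
  · rw [hmem, mem_satisfying_axisConstraints (ho _), mem_satisfying_axisConstraints (ho _)]
    exact ⟨⟨hbox _, ha _, h1⟩, hbox _, ha _, h2⟩
  · rw [hmem, mem_satisfying_axisConstraints (ho _), mem_satisfying_axisConstraints (ho _)] at hp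
    obtain ⟨⟨b1, p1, q1⟩, b2, p2, q2⟩ := hp
    have hkle : w k * (sg σ k * (p k - o k)) ≤ x k :=
      mul_le_mul_of_nonneg_left (by linarith) (hw k).le
    -- No constraint states this: it follows because a positive slope times the main offset
    -- dominates a nonnegative offset.
    have hpk : 0 ≤ sg σ k * (p k - o k) := by
      have : 0 ≤ ((m₁ : ℕ) + 1 : ℝ) / N * (w k * (sg σ k * (p k - o k))) :=
        (mul_nonneg (hw _).le p1).trans q1
      rw [mul_nonneg_iff_of_pos_left (by positivity), mul_nonneg_iff_of_pos_left (hw k)] at this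
      exact this
    have hall : ∀ P : Fin 3 → Prop, P k → P (k + 1) → P (k + 2) → ∀ i, P i := by
      intro P c0 c1 c2 i
      have : i = k ∨ i = k + 1 ∨ i = k + 2 := by omega
      rcases this with rfl | rfl | rfl <;> assumption
    apply hall
    -- On the main axis `p` lies between `o` and `a`, both of which are in the box.
    · refine ⟨?_, hpk, ?_⟩
      · have h3 := hbox k
        have h4 := ho k
        rcases sg_cases σ k with ⟨-, hs⟩ | ⟨-, hs⟩ <;> rw [hs] at hle hpk <;>
          constructor <;> linarith
      · have : 0 ≤ x k / N := div_nonneg (hx0 k) hN'.le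
        change _ ≤ x k + x k / N
        linarith
    · refine ⟨b1, p1, q1.trans (le_trans ?_ h1')⟩
      gcongr
    · refine ⟨b2, p2, q2.trans (le_trans ?_ h2')⟩
      gcongr

/-! ### Monotone norms -/

/-- The norms of the unit vectors. -/
noncomputable def weight (ν : Seminorm ℝ Point) (i : Fin 3) : ℝ := ν (Pi.single i 1)

theorem apply_single (ν : Seminorm ℝ Point) (i : Fin 3) (c : ℝ) :
    ν (Pi.single i c) = |c| * weight ν i := by
  have : (Pi.single i c : Point) = c • Pi.single i 1 := by
    rw [← Pi.single_smul, smul_eq_mul, mul_one]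
  rw [this, map_smul_eq_mul, Real.norm_eq_abs, weight]

theorem IsMonotoneNorm.weight_pos {ν : Seminorm ℝ Point} (h : IsMonotoneNorm ν) (i : Fin 3) :
    0 < weight ν i := by
  refine (apply_nonneg ν _).lt_of_ne fun h0 => ?_
  have := congrFun (h.definite _ h0.symm) i
  simp at this

theorem IsMonotoneNorm.weight_mul_le {ν : Seminorm ℝ Point} (h : IsMonotoneNorm ν) (x : Point)
    (i : Fin 3) : weight ν i * |x i| ≤ ν x := by
  rw [mul_comm, ← apply_single]
  refine h.mono _ _ fun j => ?_
  rcases eq_or_ne j i with rfl | hj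
  · simp
  · simp [hj]

/-- By monotonicity, `x` may be replaced by `|y| + z` with `z i = r / weight ν i`, and each of the
three coordinates of `z` contributes norm `r`. -/
theorem IsMonotoneNorm.le_add {ν : Seminorm ℝ Point} (h : IsMonotoneNorm ν) {x y : Point} {r : ℝ}
    (hr : 0 ≤ r) (hxy : ∀ i, weight ν i * |x i| ≤ weight ν i * |y i| + r) : ν x ≤ ν y + 3 * r := by
  have hw := h.weight_pos
  set z : Point := fun i => r / weight ν i
  have hz : ν z ≤ 3 * r := by
    have : z = ∑ i, Pi.single i (z i) := (Finset.univ_sum_single z).symm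
    rw [this, Fin.sum_univ_three]
    refine (map_add_le_add ν _ _).trans ((add_le_add_left (map_add_le_add ν _ _) _).trans ?_)
    simp only [apply_single]
    have e : ∀ i, |z i| * weight ν i = r := fun i => by
      rw [abs_of_nonneg (div_nonneg hr (hw i).le), div_mul_cancel₀ _ (hw i).ne']
    simp only [e]
    linarith
  have h1 : ν x ≤ ν (fun i => |y i| + z i) := by
    refine h.mono _ _ fun i => ?_
    have hzi : 0 ≤ z i := div_nonneg hr (hw i).le
    change |x i| ≤ |(|y i| + z i)|
    rw [abs_of_nonneg (add_nonneg (abs_nonneg _) hzi)]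
    have := hxy i
    rw [← mul_le_mul_iff_right₀ (hw i), mul_add, mul_div_cancel₀ _ (hw i).ne']
    exact this
  have h2 : ν (fun i => |y i|) ≤ ν y := h.mono _ _ fun i => by simp
  have h3 : ν (fun i => |y i| + z i) ≤ ν (fun i => |y i|) + ν z := map_add_le_add ν _ _
  linarith

/-- Pairs in the same opposite cells have almost the same distance. -/
theorem IsMonotoneNorm.sub_le {ν : Seminorm ℝ Point} (h : IsMonotoneNorm ν) {N : ℕ} (hN : 0 < N)
    {o a b c d : Point} (σ : Fin 3 → Bool) (k k' : Fin 3)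
    (ha : ∀ i, 0 ≤ sg σ i * (a i - o i)) (hb : ∀ i, 0 ≤ -sg σ i * (b i - o i))
    (hc : ∀ i, 0 ≤ sg σ i * (c i - o i)) (hd : ∀ i, 0 ≤ -sg σ i * (d i - o i))
    (hac : ∀ i, weight ν i * (sg σ i * (c i - o i)) ≤ weight ν i * (sg σ i * (a i - o i)) +
      weight ν k * (sg σ k * (a k - o k)) / N)
    (hbd : ∀ i, weight ν i * (-sg σ i * (d i - o i)) ≤ weight ν i * (-sg σ i * (b i - o i)) +
      weight ν k' * (-sg σ k' * (b k' - o k')) / N) :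
    ν (c - d) ≤ (1 + 6 / N) * ν (a - b) := by
  have hN' : (0 : ℝ) < N := by exact_mod_cast hN
  have habs : ∀ x y : Point, (∀ i, 0 ≤ sg σ i * (x i - o i)) → (∀ i, 0 ≤ -sg σ i * (y i - o i)) →
      ∀ i, |(x - y) i| = sg σ i * (x i - o i) + -sg σ i * (y i - o i) := by
    intro x y hx hy i
    have h1 := hx i
    have h2 := hy i
    rw [Pi.sub_apply]
    rcases sg_cases σ i with ⟨-, hs⟩ | ⟨-, hs⟩ <;> rw [hs] at h1 h2 ⊢
    · rw [abs_of_nonneg (by linarith)]; ring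
    · rw [abs_of_nonpos (by linarith)]; ring
  have hak : weight ν k * (sg σ k * (a k - o k)) ≤ ν (a - b) := by
    refine le_trans ?_ (h.weight_mul_le (a - b) k)
    rw [habs a b ha hb]
    exact mul_le_mul_of_nonneg_left (by linarith [hb k]) (h.weight_pos k).le
  have hbk : weight ν k' * (-sg σ k' * (b k' - o k')) ≤ ν (a - b) := by
    refine le_trans ?_ (h.weight_mul_le (a - b) k')
    rw [habs a b ha hb]
    exact mul_le_mul_of_nonneg_left (by linarith [ha k']) (h.weight_pos k').le
  have hak' := div_le_div_of_nonneg_right hak hN'.le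
  have hbk' := div_le_div_of_nonneg_right hbk hN'.le
  -- Each end contributes an excess of at most `ν (a - b) / N`, since its main offset is part of a
  -- coordinate difference of `a` and `b`.
  have := h.le_add (x := c - d) (y := a - b) (r := 2 * (ν (a - b) / N))
    (by have := apply_nonneg ν (a - b); positivity) (fun i => by
      rw [habs c d hc hd, habs a b ha hb, mul_add, mul_add]
      linarith [hac i, hbd i])
  refine this.trans (le_of_eq ?_)
  ring

/-! ### Numerical bounds -/

/-- From `2 ^ (clog - 1) < n` the left side is at most `2 + log n / log 2 ≤ 3 * log n / log 2`, and
`3 / log 2 < 5`. -/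
theorem clog_add_one_le {n : ℕ} (hn : 2 ≤ n) : ((Nat.clog 2 n : ℕ) + 1 : ℝ) ≤ 5 * Real.log n := by
  have hlog2 : 0.6931471803 < Real.log 2 := Real.log_two_gt_d9
  have h0 : (2 : ℝ) ≤ n := by exact_mod_cast hn
  have h2 : Real.log 2 ≤ Real.log n := Real.log_le_log (by norm_num) h0
  have h3 : 2 ^ (Nat.clog 2 n - 1) < n := Nat.pow_pred_clog_lt_self (by norm_num) (by omega)
  have hpos : 0 < Nat.clog 2 n := Nat.clog_pos (by norm_num) hn
  have h4 : ((Nat.clog 2 n - 1 : ℕ) : ℝ) * Real.log 2 ≤ Real.log n := by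
    rw [← Real.log_pow]
    exact Real.log_le_log (by positivity) (by exact_mod_cast h3.le)
  rw [Nat.cast_sub hpos] at h4
  push_cast at h4
  have h5 : (0 : ℝ) ≤ (Nat.clog 2 n : ℝ) - 1 := by
    have : (1 : ℝ) ≤ Nat.clog 2 n := by exact_mod_cast hpos
    linarith
  nlinarith

/-- The constant in the time bound. -/
def timeConst : ℕ :=
  (startCode.cost + 2 + displayCode.cost + 29 * (1 + visitCode.cost)) +
    (4 * (2 + outerHead.cost) + 16 * (1 + pairCode.cost) + 1)

theorem queryTime_le {M P v : ℕ} (hM : 1 ≤ M) (hP : 1 ≤ P) (hv : v ≤ M * (23 * P + 5) + 1) :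
    queryTime v (2 * (M + 1)) ≤ timeConst * (M * P + M ^ 2) := by
  have hMP : 1 ≤ M * P := Nat.mul_pos hM hP
  have hMM : M ≤ M ^ 2 := by nlinarith
  have hM1 : M ≤ M * P := Nat.le_mul_of_pos_right _ hP
  have hv' : v ≤ 29 * (M * P) := hv.trans (by nlinarith)
  have h1 : v * (1 + visitCode.cost) ≤ 29 * (M * P) * (1 + visitCode.cost) := by gcongr
  have h2 : scanTime (2 * (M + 1)) ≤
      (4 * (2 + outerHead.cost) + 16 * (1 + pairCode.cost) + 1) * M ^ 2 := by
    unfold scanTime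
    have : 2 * (M + 1) ≤ 4 * M := by omega
    calc _ ≤ 4 * M * (1 + (outerHead.cost + (4 * M * (1 + pairCode.cost) + 1))) + 1 := by gcongr
      _ = 4 * (2 + outerHead.cost) * M + 16 * (1 + pairCode.cost) * M ^ 2 + 1 := by ring
      _ ≤ 4 * (2 + outerHead.cost) * M ^ 2 + 16 * (1 + pairCode.cost) * M ^ 2 + M ^ 2 := by
          gcongr; nlinarith
      _ = _ := by ring
  unfold queryTime timeConst
  generalize startCode.cost = a at *
  generalize visitCode.cost = b at *
  generalize displayCode.cost = c at *
  generalize (4 * (2 + outerHead.cost) + 16 * (1 + pairCode.cost) + 1) = d at *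
  calc a + (v * (1 + b) + 1 + (1 + (scanTime (2 * (M + 1)) + c)))
      ≤ (a + 2 + c) * 1 + 29 * (M * P) * (1 + b) + d * M ^ 2 := by omega
    _ ≤ (a + 2 + c) * (M * P) + 29 * (M * P) * (1 + b) + d * M ^ 2 := by gcongr
    _ ≤ (a + 2 + c + 29 * (1 + b) + d) * (M * P + M ^ 2) := by ring_nf; nlinarith

theorem space_le {n M P s : ℕ} (hn : 1 ≤ n) (hM : 1 ≤ M) (hP : 1 ≤ P)
    (hs : s ≤ M * (23 * n * P + 5) + 1) :
    20 * (n + s) + (4 * (M * (23 * P + 5) + 1) + 2) ≤ 720 * (M * n * P) := by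
  have h1 : 1 ≤ n * P := Nat.mul_pos hn hP
  have h2 : 1 ≤ M * (n * P) := Nat.mul_pos hM h1
  have h3 : n ≤ M * (n * P) := (Nat.le_mul_of_pos_right n hP).trans (Nat.le_mul_of_pos_left _ hM)
  have h4 : M ≤ M * (n * P) := Nat.le_mul_of_pos_right _ h1
  have h5 : M * P ≤ M * (n * P) := Nat.mul_le_mul_left _ (Nat.le_mul_of_pos_left _ hn)
  have e1 : M * (23 * n * P + 5) = 23 * (M * (n * P)) + 5 * M := by ring
  have e2 : M * (23 * P + 5) = 23 * (M * P) + 5 * M := by ring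
  have e3 : M * n * P = M * (n * P) := by ring
  rw [e1] at hs
  rw [e2, e3]
  omega

/-- The constant in the theorem. -/
def totalConst : ℕ := 720 * 18375000 + timeConst * 18375000 + timeConst * 1382976

theorem numeric_bounds {ε : ℝ} (hε : 0 < ε) {n : ℕ} (hn : 2 ≤ n) :
    ∃ N : ℕ, 0 < N ∧ 6 / (N : ℝ) ≤ ε ∧
      (∀ s v : ℕ, s ≤ 24 * N ^ 2 * (23 * n * (Nat.clog 2 n + 1) ^ 6 + 5) + 1 →
        v ≤ 24 * N ^ 2 * (23 * (Nat.clog 2 n + 1) ^ 6 + 5) + 1 →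
        ((20 * (n + s) + (4 * (24 * N ^ 2 * (23 * (Nat.clog 2 n + 1) ^ 6 + 5) + 1) + 2) : ℕ) : ℝ) ≤
          totalConst * ((max 1 ε⁻¹) ^ 2 * n * Real.log n ^ 6) ∧
        (queryTime v (2 * (24 * N ^ 2 + 1)) : ℝ) ≤
          totalConst * ((max 1 ε⁻¹) ^ 2 * Real.log n ^ 6 + (max 1 ε⁻¹) ^ 4)) := by
  set E := max 1 ε⁻¹
  have hE1 : 1 ≤ E := le_max_left _ _
  have hE2 : ε⁻¹ ≤ E := le_max_right _ _
  have hN0 : 0 < ⌈6 * E⌉₊ := Nat.ceil_pos.2 (by linarith)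
  have hNge : 6 * E ≤ ⌈6 * E⌉₊ := Nat.le_ceil _
  have hNle : (⌈6 * E⌉₊ : ℝ) ≤ 7 * E := by
    have := Nat.ceil_lt_add_one (show (0 : ℝ) ≤ 6 * E by linarith)
    linarith
  refine ⟨⌈6 * E⌉₊, hN0, ?_, fun s v hs hv => ?_⟩
  · rw [div_le_iff₀ (by exact_mod_cast hN0)]
    have : 1 ≤ ε * E := by rwa [← inv_le_iff_one_le_mul₀' hε]
    nlinarith
  generalize ⌈6 * E⌉₊ = N at *
  have hM : 1 ≤ 24 * N ^ 2 := by
    have := Nat.pow_pos (n := 2) hN0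
    omega
  have hP : 1 ≤ (Nat.clog 2 n + 1) ^ 6 := Nat.one_le_pow _ _ (by omega)
  -- Here `1176 = 24 * 7 ^ 2`; below, `15625 = 5 ^ 6`, `18375000 = 1176 * 15625` and `1382976 = 1176
  -- ^ 2`.
  have hMle : ((24 * N ^ 2 : ℕ) : ℝ) ≤ 1176 * E ^ 2 := by
    push_cast
    have : (N : ℝ) ^ 2 ≤ (7 * E) ^ 2 := by gcongr
    nlinarith
  have hPle : (((Nat.clog 2 n + 1) ^ 6 : ℕ) : ℝ) ≤ 15625 * Real.log n ^ 6 := by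
    have := pow_le_pow_left₀ (by positivity) (clog_add_one_le hn) 6
    push_cast
    calc _ ≤ _ := this
      _ = _ := by ring
  have h1 := space_le (n := n) (by omega) hM hP hs
  have h2 := queryTime_le hM hP hv
  generalize 24 * N ^ 2 = M at *
  generalize (Nat.clog 2 n + 1) ^ 6 = P at *
  have hlog : 0 ≤ Real.log n ^ 6 := by
    have : (0 : ℝ) ≤ P := by positivity
    linarith
  generalize Real.log n ^ 6 = Λ at *
  have hMP : (M : ℝ) * P ≤ 18375000 * (E ^ 2 * Λ) := by
    calc (M : ℝ) * P ≤ (1176 * E ^ 2) * (15625 * Λ) := by gcongr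
      _ = _ := by ring
  have hMM : (M : ℝ) ^ 2 ≤ 1382976 * E ^ 4 := by
    calc (M : ℝ) ^ 2 ≤ (1176 * E ^ 2) ^ 2 := by gcongr
      _ = _ := by ring
  have hE2' : 0 ≤ E ^ 2 * Λ := by positivity
  have hK : (0 : ℝ) ≤ timeConst := Nat.cast_nonneg _
  constructor
  · calc _ ≤ ((720 * (M * n * P) : ℕ) : ℝ) := by exact_mod_cast h1
      _ = 720 * (M * P) * n := by push_cast; ring
      _ ≤ 720 * (18375000 * (E ^ 2 * Λ)) * n := by gcongr
      _ = (720 * 18375000) * (E ^ 2 * n * Λ) := by ring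
      _ ≤ _ := by
        gcongr
        unfold totalConst
        push_cast
        linarith
  · calc _ ≤ ((timeConst * (M * P + M ^ 2) : ℕ) : ℝ) := by exact_mod_cast h2
      _ = timeConst * (M * P + M ^ 2) := by push_cast; ring
      _ ≤ timeConst * (18375000 * (E ^ 2 * Λ) + 1382976 * E ^ 4) := by gcongr
      _ = (timeConst * 18375000) * (E ^ 2 * Λ) + (timeConst * 1382976) * E ^ 4 := by ring
      _ ≤ totalConst * (E ^ 2 * Λ) + totalConst * E ^ 4 := by
        unfold totalConst
        gcongr <;> push_cast <;> linarith
      _ = _ := by ring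

/-! ### Correctness -/

theorem mem_anchoredBich {κ : Type*} {S : Finset Point} {cl : Point → κ} {l u o a b : Point}
    {cw : Point → ℕ} (ha : a ∈ S) (hb : b ∈ S)
    (hcw : ∀ a ∈ S, ∀ b ∈ S, (cw a = cw b ↔ cl a = cl b)) :
    Recognisable cw l u o a b (anchoredBich S cl (box l u) o) := by
  simp only [Recognisable, anchoredBich, bich, boundingBox, box, Set.mem_ofPred_eq, ha, hb,
    true_and, forall_and, ne_eq, hcw a ha b hb]
  tauto

/-- Colours can be numbered. -/
theorem exists_colour_numbers {κ : Type*} (S : Finset Point) (cl : Point → κ) :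
    ∃ cw : Point → ℕ, (∀ a ∈ S, ∀ b ∈ S, (cw a = cw b ↔ cl a = cl b)) ∧ (∀ a, cw a ≠ 0) ∧
      ∀ a ∈ S, cw a ≤ S.card := by
  classical
  refine ⟨fun a => (S.image cl).toList.idxOf (cl a) + 1, fun a ha b hb => ?_, fun a => by simp,
    fun a ha => ?_⟩
  · rw [add_left_inj]
    exact List.idxOf_inj (Finset.mem_toList.2 (Finset.mem_image_of_mem _ ha))
  · have h1 := List.idxOf_lt_length_iff.2
      (Finset.mem_toList.2 (Finset.mem_image_of_mem cl ha))
    rw [Finset.length_toList] at h1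
    exact h1.trans_le Finset.card_image_le

/-- For every anchored pair `(a, b)` some pair `(c, d)` of candidates is almost as close. -/
theorem exists_candidates {κ : Type*} {S : Finset Point} {cl : Point → κ} {l u o : Point}
    {cw ptr : Point → ℕ} {ν : Seminorm ℝ Point} (hν : IsMonotoneNorm ν) {N : ℕ} (hN : 0 < N)
    (hcw : ∀ a ∈ S, ∀ b ∈ S, (cw a = cw b ↔ cl a = cl b)) {vals : Cell N → ℝ}
    (hvals : ∀ t, ∀ p ∈ S, cellValue t p < vals t) {out : List ℕ}
    (hout : ∀ t : Cell N, ∃ A, Covers ptr cw (cellValue t) (vals t)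
      (↑S ∩ satisfying (cellConstraints (weight ν) t) (queryVector l u o)) A ∧
      A.p₁ ∈ out ∧ A.p₂ ∈ out)
    {a b : Point} (hab : (a, b) ∈ anchoredBich S cl (box l u) o) :
    ∃ c ∈ S, ∃ d ∈ S, ptr c ∈ out ∧ ptr d ∈ out ∧ (c, d) ∈ anchoredBich S cl (box l u) o ∧
      ν (c - d) ≤ (1 + 6 / N) * ν (a - b) := by
  classical
  obtain ⟨⟨haS, hbS, hne⟩, hanch, haB, hbB⟩ := hab
  simp only at haS hbS hne haB hbB
  have ho : ∀ i, l i ≤ o i ∧ o i ≤ u i := fun i =>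
    ⟨(le_min (haB i).1 (hbB i).1).trans (hanch i).1, (hanch i).2.trans (max_le (haB i).2 (hbB i).2)⟩
  -- The octant of `a`; where the test fails, anchoring forces `a i ≤ o i ≤ b i`. The opposite
  -- octant then contains `b`.
  set σ : Fin 3 → Bool := fun i => decide (b i ≤ o i ∧ o i ≤ a i) with hσ
  have hsig : ∀ i, 0 ≤ sg σ i * (a i - o i) ∧ 0 ≤ -sg σ i * (b i - o i) := by
    intro i
    have hi := hanch i
    simp only [min_le_iff, le_max_iff] at hi
    rcases sg_cases σ i with ⟨h, hs⟩ | ⟨h, hs⟩ <;> rw [hs] <;> simp only [hσ, decide_eq_true_eq,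
      decide_eq_false_iff_not] at h
    · constructor <;> linarith [h.1, h.2]
    · have : a i ≤ o i ∧ o i ≤ b i := by
        rcases le_total (b i) (o i) with h1 | h1
        · have h2 : a i < o i := by
            by_contra h3
            exact h ⟨h1, not_lt.1 h3⟩
          rcases hi.2 with h4 | h4
          exacts [absurd h4 (not_le.2 h2), ⟨h2.le, h4⟩]
        · refine ⟨?_, h1⟩
          rcases hi.1 with h4 | h4
          · exact h4
          · by_contra h5
            exact h ⟨h4, (not_le.1 h5).le⟩
      constructor <;> linarith [this.1, this.2]
  obtain ⟨k, m₁, m₂, hka, hkp⟩ := exists_cell hN hν.weight_pos σ (fun i => (hsig i).1) haB ho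
  obtain ⟨k', m₁', m₂', hkb, hkp'⟩ := exists_cell hN hν.weight_pos (fun i => !σ i)
    (fun i => by rw [sg_not]; exact (hsig i).2) hbB ho
  obtain ⟨A, hA, hA1, hA2⟩ := hout (σ, k, m₁, m₂)
  obtain ⟨B, hB, hB1, hB2⟩ := hout (fun i => !σ i, k', m₁', m₂')
  obtain ⟨c, hc, d, hd, mc, md, hcd, hca, hdb⟩ := hA.select_pair hB
    (fun p hp => hvals _ p hp.1) (fun p hp => hvals _ p hp.1) ⟨haS, hka⟩ ⟨hbS, hkb⟩
    (fun h => hne ((hcw a haS b hbS).1 h))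
  have hc' := hkp c hc.2 hca
  have hd' := hkp' d hd.2 hdb
  simp only [sg_not] at hd'
  refine ⟨c, hc.1, d, hd.1, ?_, ?_, ⟨⟨hc.1, hd.1, ?_⟩, ?_, fun i => (hc' i).1, fun i => (hd' i).1⟩,
    ?_⟩
  · rcases mc with h | h <;> rw [← h] <;> assumption
  · rcases md with h | h <;> rw [← h] <;> assumption
  · exact fun h => hcd ((hcw c hc.1 d hd.1).2 h)
  · intro i
    have h1 := (hc' i).2.1
    have h2 := (hd' i).2.1
    simp only [min_le_iff, le_max_iff]
    rcases sg_cases σ i with ⟨-, hs⟩ | ⟨-, hs⟩ <;> rw [hs] at h1 h2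
    · exact ⟨Or.inr (by linarith), Or.inl (by linarith)⟩
    · exact ⟨Or.inl (by linarith), Or.inr (by linarith)⟩
  · exact hν.sub_le hN σ k k' (fun i => (hsig i).1) (fun i => (hsig i).2) (fun i => (hc' i).2.1)
      (fun i => (hd' i).2.1) (fun i => (hc' i).2.2) (fun i => (hd' i).2.2)

theorem finite_anchoredBich {κ : Type*} (S : Finset Point) (cl : Point → κ) (X : Set Point)
    (o : Point) : (anchoredBich S cl X o).Finite :=
  (S ×ˢ S).finite_toSet.subset fun φ hφ => by
    simpa using ⟨hφ.1.1, hφ.1.2.1⟩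

theorem queryTime_mono {v v' m : ℕ} (h : v ≤ v') : queryTime v m ≤ queryTime v' m := by
  unfold queryTime
  gcongr

theorem length_cellConstraints (w : Point) {N : ℕ} (t : Cell N) :
    (cellConstraints w t).length = 6 := rfl

theorem card_cell (N : ℕ) : (Finset.univ : Finset (Cell N)).toList.length = 24 * N ^ 2 := by
  simp only [Finset.length_toList, Finset.card_univ, Fintype.card_prod, Fintype.card_fun,
    Fintype.card_bool, Fintype.card_fin]
  ring

/-- One range tree per cell, all chained; `23 = 3 * 6 + 5` comes from six constraints per cell. The
working memory `4 * V + 2` suffices for any traversal of at most `V` visits. -/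
theorem exists_dataStructure {κ : Type*} {δ : Point → Point → ℝ} {ν : Seminorm ℝ Point}
    (hν : IsMonotoneNorm ν) (hδ : ∀ a b, δ a b = ν (a - b)) {ε : ℝ} {N : ℕ} (hN : 0 < N)
    (hNε : 6 / (N : ℝ) ≤ ε) (S : Finset Point) (cl : Point → κ) (hS : 2 ≤ S.card) {P : ℕ}
    (hP : P = (Nat.clog 2 S.card + 1) ^ 6) :
    ∃ (D : DataStructure) (s : ℕ), D.WordSized ∧
      D.space = 20 * (S.card + s) + (4 * (24 * N ^ 2 * (23 * P + 5) + 1) + 2) ∧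
      s ≤ 24 * N ^ 2 * (23 * S.card * P + 5) + 1 ∧
      IsAnchoredCRCP queryProgram δ ε S cl D
        (queryTime (24 * N ^ 2 * (23 * P + 5) + 1) (2 * (24 * N ^ 2 + 1))) := by
  classical
  obtain ⟨cw, hcw, hcw0, hcwle⟩ := exists_colour_numbers S cl
  set n := S.card with hn
  set pts := S.toList with hpts
  have hlen : pts.length = n := Finset.length_toList S
  have hpm : ∀ {a}, a ∈ pts ↔ a ∈ S := Finset.mem_toList
  set ptr : Point → ℕ := fun a => 10 * pts.idxOf a with hptr
  have hidx : ∀ a ∈ S, pts.idxOf a < n := fun a ha => by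
    rw [← hlen]
    exact List.idxOf_lt_length_iff.2 (hpm.2 ha)
  have hget : ∀ a ∈ S, pts[pts.idxOf a]? = some a := fun a ha =>
    List.getElem?_idxOf (hpm.2 ha)
  have hne : S.Nonempty := Finset.card_pos.1 (by omega)
  have htree : ∀ t : Cell N, ∃ T : Tree,
      IsRangeTree ptr cw (cellValue t) (10 * n) (cellConstraints (weight ν) t) S T ∧
        T.size + 1 ≤ 23 * n * P ∧ ∀ q, T.visits q + 1 ≤ 23 * P := by
    intro t
    have := exists_rangeTree (ptr := ptr) (col := cw) (g := cellValue t) (B := 10 * n)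
      (cellConstraints (weight ν) t) (Nat.clog 2 n) S hne (Nat.le_pow_clog (by norm_num) _)
      (fun p hp => ⟨by have := hidx p hp; simp only [hptr]; omega, by
        have := hcwle p hp; omega⟩) (fun p _ => hcw0 p)
    simpa only [length_cellConstraints, ← hP] using this
  choose f hf hfs hfv using htree
  have hval : ∀ t : Cell N, ∃ v, ∀ p ∈ S, cellValue t p < v := by
    intro t
    obtain ⟨m, -, hm⟩ := Finset.exists_max_image S (cellValue t) hne
    exact ⟨cellValue t m + 1, fun p hp => by linarith [hm p hp]⟩
  choose vals hvals using hval
  set tasks := (Finset.univ : Finset (Cell N)).toList with htasks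
  have hcard : tasks.length = 24 * N ^ 2 := card_cell N
  set T := chain f vals tasks with hT
  set V := 24 * N ^ 2 * (23 * P + 5) + 1 with hV
  have hsize : T.size ≤ 24 * N ^ 2 * (23 * n * P + 5) + 1 := by
    rw [← hcard]
    exact size_chain tasks fun t _ => by have := hfs t; omega
  have hvisits : ∀ q, T.visits q ≤ V := fun q => by
    rw [hV, ← hcard]
    exact visits_chain tasks fun t _ => by have := hfv t q; omega
  have hM : 1 ≤ 24 * N ^ 2 := by
    have := Nat.pow_pos (n := 2) hN
    omega
  have hVM : 24 * N ^ 2 + 1 ≤ V := by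
    rw [hV]
    nlinarith [Nat.zero_le (24 * N ^ 2 * (23 * P))]
  refine ⟨layout cw pts T (4 * V + 2), T.size, ?_, ?_, hsize, ?_⟩
  · refine wordSized_layout (fun a ha => ?_) (bounded_chain _ fun t _ => ?_)
    · rw [hlen]; exact hcwle a (hpm.1 ha)
    · rw [hlen]; exact (hf t).bounded
  · rw [space_layout, hlen]
  intro l u o s hs
  set q := queryVector l u o with hq
  set Pi := anchoredBich S cl (box l u) o with hPi
  obtain ⟨a₀, ha₀⟩ : ∃ a, pts[0]? = some a :=
    ⟨pts[0]'(by omega), List.getElem?_eq_getElem (by omega)⟩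
  obtain ⟨-, hvalid, hoc, hcov⟩ := process_chain (f := f) (vals := vals) (q := q)
    (P := fun t A => Covers ptr cw (cellValue t) (vals t)
      (↑S ∩ satisfying (cellConstraints (weight ν) t) q) A)
    (V := fun p => ∃ i < n, p = 10 * i) tasks Acc.start
    (fun t _ A => ⟨by simpa using (hf t).covers (vals t) q ∅ _ (covers_flush A), (hf t).out q _⟩)
    (fun t A hA => by
      constructor
      · rcases hA.mem₁ with ⟨a, ha, h, -⟩ | ⟨h, -⟩
        exacts [⟨_, hidx a ha.1, h⟩, ⟨0, by omega, h⟩]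
      · rcases hA.mem₂ with ⟨a, ha, h, -⟩ | ⟨h, -⟩
        exacts [⟨_, hidx a ha.1, h⟩, ⟨0, by omega, h⟩])
    ⟨⟨0, by omega, rfl⟩, ⟨0, by omega, rfl⟩⟩ (by simp [Acc.start])
  set out := (T.process q Acc.start).out with hout
  have hoc' : out.length = 2 * (24 * N ^ 2 + 1) := by
    rw [← hcard, hout, hT, hoc]
    simp [Acc.start]
  set cand := out.map fun p => pts.getD (p / 10) 0 with hcand
  have hcl : cand.length = 2 * (24 * N ^ 2 + 1) := by rw [hcand, List.length_map, hoc']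
  have hgetD : ∀ p ∈ out, pts[p / 10]? = some (pts.getD (p / 10) 0) ∧ p = 10 * (p / 10) := by
    intro p hp
    obtain ⟨i, hi, rfl⟩ := hvalid p hp
    have hi' : i < pts.length := by omega
    simp [hi']
  have hcandS : ∀ a ∈ cand, a ∈ S := by
    intro a ha
    obtain ⟨p, hp, rfl⟩ := List.mem_map.1 ha
    exact hpm.1 (List.mem_of_getElem? (hgetD p hp).1)
  have hmem : ∀ a ∈ S, ptr a ∈ out → a ∈ cand := by
    intro a ha hp
    refine List.mem_map.2 ⟨_, hp, ?_⟩
    have h1 := (hgetD _ hp).1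
    simp only [hptr, Nat.mul_div_cancel_left _ (by norm_num : 0 < 10), hget a ha] at h1 ⊢
    exact (Option.some.inj h1).symm
  have hRec : ∀ a ∈ cand, ∀ b ∈ cand, Recognisable cw l u o a b Pi := fun a ha b hb =>
    mem_anchoredBich (hcandS a ha) (hcandS b hb) hcw
  obtain ⟨s', t, he, ht, hres⟩ := runs_queryProgram (δ := δ) (T := T) (s := s) (cand := cand)
    (cw := cw) (Pi := Pi) hs (root_layout cw T (4 * V + 2) ha₀) (rep_layout cw pts T (4 * V + 2))
    (Nat.add_le_add_right (Nat.mul_le_mul_left 4 (hvisits q)) 2) (by simp only [layout]; omega)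
    (by rw [hcl, ← hoc'])
    (fun i h h' => by
      have hp := hgetD _ (List.getElem_mem h')
      have := pointAt_layout cw T (4 * V + 2) hp.1
      rw [← hp.2] at this
      simpa [hcand] using this) hRec
  refine ⟨s', t, he, ?_, ?_, ?_⟩
  · rw [hcl] at ht
    exact_mod_cast ht.trans (queryTime_mono (hvisits q))
  · intro hne
    -- The reported pair is optimal among the candidates, hence no worse than the replacement of an
    -- exactly closest pair.
    obtain ⟨ψ, hψ, hmin⟩ := Set.exists_min_image Pi (fun φ => δ φ.1 φ.2)
      (finite_anchoredBich S cl _ o) hne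
    obtain ⟨c, hc, d, hd, hpc, hpd, hcd, hle⟩ := exists_candidates (out := out) hν hN hcw hvals
      (fun t => hcov t (Finset.mem_toList.2 (Finset.mem_univ t))) (a := ψ.1) (b := ψ.2) hψ
    have hc' := hmem c hc hpc
    have hd' := hmem d hd hpd
    rcases hres with ⟨-, h⟩ | ⟨h0, h1, h2⟩
    · exact absurd hcd (h c hc' d hd')
    · refine ⟨h0, h1, ψ, ⟨hψ, hmin⟩, (h2 c hc' d hd' hcd).trans ?_⟩
      rw [hδ, hδ]
      exact hle.trans (mul_le_mul_of_nonneg_right (by linarith) (apply_nonneg ν _))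
  · intro hempty
    rcases hres with ⟨h, -⟩ | ⟨-, h1, -⟩
    · exact h
    · rw [hempty] at h1
      exact h1.elim

end CRCP

/-! ### The theorem -/

theorem mainTheorem10 :
    ∃ (P : CRCP.Program) (C : ℝ),
      ∀ δ : CRCP.Point → CRCP.Point → ℝ, CRCP.InducedByMonotoneNorm δ →
      ∀ ε : ℝ, 0 < ε →
      ∀ (κ : Type*) (S : Finset CRCP.Point) (cl : CRCP.Point → κ), 2 ≤ S.card →
      ∃ D : CRCP.DataStructure,
        D.WordSized ∧
        (D.space : ℝ) ≤ C * ((max 1 ε⁻¹) ^ 2 * S.card * Real.log S.card ^ 6) ∧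
        CRCP.IsAnchoredCRCP P δ ε S cl D
          (C * ((max 1 ε⁻¹) ^ 2 * Real.log S.card ^ 6 + (max 1 ε⁻¹) ^ 4)) := by
  refine ⟨CRCP.queryProgram, CRCP.totalConst, ?_⟩
  rintro δ ⟨ν, hν, hδ⟩ ε hε κ S cl hS
  obtain ⟨N, hN, hNε, hb⟩ := CRCP.numeric_bounds hε hS
  obtain ⟨D, s, hword, hspace, hs, hD⟩ :=
    CRCP.exists_dataStructure hν hδ hN hNε S cl hS rfl
  obtain ⟨b1, b2⟩ := hb s _ hs le_rfl
  refine ⟨D, hword, by rw [hspace]; exact b1, fun l u o st hq => ?_⟩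
  obtain ⟨st', t, he, ht, hans⟩ := hD l u o st hq
  exact ⟨st', t, he, ht.trans b2, hans⟩
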